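/- For a positive integer $k$, write $[k]=\{1,\ldots,k\}$. A $k$-plane tree is a (finite, nonempty) rooted plane tree, i.e. a rooted tree in which the order of branches matters, whose vertices are labelled by elements of $[k]$ in such a way that the sum of the two labels along any edge is at most $k+1$. Empty products are $1$ and empty sums are $0$, and $\binom{x}{m}=\frac{x(x-1)\cdots(x-m+1)}{m!}$ for an integer $x$ and an integer $m\ge 0$ (in particular $\binom{-1}{0}=1$). Let $\ell_1,\ldots,\ell_k$ be nonnegative integers and let $n=\ell_1+\ell_2+\cdots+\ell_k>1$. Let $h\in[k]$. The number of $k$-plane trees with root label $h$, $\ell_i$ vertices labelled $i$ for every $i\in[k]$, and $n$ vertices in total is finite and is given by $$\frac{\ell_h}{n(2n-1)} \prod_{r=1}^{\lceil k/2 \rceil} \binom{2n-1-\sum_{j=1}^{r-1} \ell_j - \sum_{j=k+2-r}^k \ell_j}{\ell_r} \prod_{r=1}^{h-1} \binom{\sum_{j=1}^{r} \ell_j + \sum_{j=k+1-r}^k \ell_j - 1}{\ell_{k+1-r}} \prod_{r=h}^{\lfloor k/2 \rfloor} \binom{\sum_{j=1}^{r} \ell_j + \sum_{j=k+1-r}^k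 \ell_j}{\ell_{k+1-r}}$$ if $h \leq \lceil k/2 \rceil$, and by $$\frac{\ell_h}{(n-1)(2n-1)} \prod_{r=1}^{k+1-h} \binom{2n-1-\sum_{j=1}^{r-1} \ell_j - \sum_{j=k+2-r}^k \ell_j}{\ell_r} \prod_{r=k+2-h}^{\lceil k/2 \rceil} \binom{2n-2-\sum_{j=1}^{r-1} \ell_j - \sum_{j=k+2-r}^k \ell_j}{\ell_r} \prod_{r=1}^{\lfloor k/2 \rfloor} \binom{\sum_{j=1}^{r} \ell_j + \sum_{j=k+1-r}^k \ell_j - 1}{\ell_{k+1-r}}$$ if $h > \lceil k/2 \rceil$. The total number of $k$-plane trees with $\ell_i$ vertices labelled $i$ for every $i\in[k]$ and $n$ vertices in total is finite and equal to $$\frac{1}{n-1} \prod_{r=1}^{\lceil k/2 \rceil} \binom{2n-2-\sum_{j=1}^{r-1} \ell_j - \sum_{j=k+2-r}^k \ell_j}{\ell_r} \prod_{r=1}^{\lfloor k/2 \rfloor} \binom{\sum_{j=1}^{r} \ell_j + \sum_{j=k+1-r}^k \ell_j - 1}{\ell_{k+1-r}}.$$ -/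

import Mathlib

/-- Finite rooted plane (ordered) trees with vertices labelled by elements of `α`: a root with its
label, and the (possibly empty) ordered list of its branches. -/
inductive PlaneTree (α : Type) : Type
  | node (a : α) (branches : List (PlaneTree α)) : PlaneTree α

namespace PlaneTree

/-- The label of the root. -/
def rootLabel {α : Type} : PlaneTree α → α
  | node a _ => a

/-- The labels of all the vertices, one entry for each vertex, listed in preorder. -/
def labels {α : Type} : PlaneTree α → List α
  | node a ts => a :: ts.flatMap labels

/-- The number of vertices. -/
def numVertices {α : Type} (T : PlaneTree α) : ℕ := T.labels.length

/-- The number of vertices labelled `i`. -/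
def labelCount {α : Type} [DecidableEq α] (i : α) (T : PlaneTree α) : ℕ := T.labels.count i

/-- `k`-plane trees: all vertex labels lie in `{1, …, k}`, and the sum of the two labels at the ends
of any edge (which joins a vertex to the root of one of its branches) is at most `k + 1`. -/
inductive IsKPlane (k : ℕ) : PlaneTree ℕ → Prop
  | node (a : ℕ) (ts : List (PlaneTree ℕ)) (one_le : 1 ≤ a) (le : a ≤ k)
      (edge : ∀ t ∈ ts, a + t.rootLabel ≤ k + 1)
      (branch : ∀ t ∈ ts, IsKPlane k t) : IsKPlane k (PlaneTree.node a ts)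

/-- The set of `k`-plane trees with `n` vertices, of which `ℓ i` are labelled `i`, for each `i` in
`{1, …, k}` (values of `ℓ` outside this range play no role). -/
def kPlaneTrees (k n : ℕ) (ℓ : ℕ → ℕ) : Set (PlaneTree ℕ) :=
  {T | IsKPlane k T ∧ T.numVertices = n ∧ ∀ i ∈ Finset.Icc 1 k, T.labelCount i = ℓ i}

/-- The trees of `kPlaneTrees k n ℓ` whose root is labelled `h`. -/
def kPlaneTreesWithRoot (k n : ℕ) (ℓ : ℕ → ℕ) (h : ℕ) : Set (PlaneTree ℕ) :=
  {T | T ∈ kPlaneTrees k n ℓ ∧ T.rootLabel = h}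

end PlaneTree

/-!
Let `T_h` be the generating function of the `k`-plane trees with root label `h`, where `X` marks
vertices and a vertex labelled `a` carries a variable, and let `U_a = 1 - ∑_{h ≤ a} T_h`. Cutting
off the first branch gives `T_h * U_{k + 1 - h} = X * x_h`, that is
`(U_{h - 1} - U_h) * U_{k + 1 - h} = X * x_h` (`PlaneTree.treeSeries_eq`). In the order
`v₀ = U_0 = 1, v₁ = U_k, v₂ = U_1, v₃ = U_{k - 1}, …` these equations say that consecutive products
`v_j * v_{j + 1}` differ by `± X * x_j`, if the labels are listed as `1, k, 2, k - 1, …` and `x_j`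
belongs to the `j`-th of them; the list ends with `v_{k + 1} = v_k`. Hence
`v_j * v_{j + 1} = v_k² * L_j` with the explicit linear factors
`L_j = 1 + y * ∑_{j ≤ i < k} ± x_i`, where `y = X / v_k²`, and `v₀ = 1` forces `1 / v_k = B_k`,
where `B_j = L_0 / L_1 * L_2 / L_3 ⋯` is the alternating product of the first `j` factors. So
`y = X * B_k(y)²`: everything is explicit in terms of `y`, and `y` is the solution of a Lagrange
equation with `φ = B_k²`. The substitution is never inverted: `X / φ` is substituted for `X` in the
generating functions, the result is identified by uniqueness of the solution of the system
(`substDivUnit_treeSeries`), and the coefficients are recovered by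
`succ_mul_coeff_eq_coeff_derivative_substDivUnit`.

For all trees this gives `(n - 1) [X^n] ∑ T_h = [y^n] B_k^(2n - 2)`. For root label `h`, at position
`j` of the list, Lagrange inversion produces the derivative with respect to `y` of `B_{j + 1}` or of
`y / B_{j + 1}`. All factors of `B_{j + 1}` involve `x_j`, with the same sign, so that this
derivative can be traded for the one with respect to `x_j` (`eulerPderiv_altProd`), and the latter
turns the product with a power of `B_k` into the derivative of a single product of powers of the
`L_i` (`coeffPderiv_altProd_zpow_mul`); it is responsible for the factor `ℓ h / (2n - 1)`.

Finally, the coefficient of a monomial in a product of powers of the `L_i` is a product of binomial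
coefficients (`diagCoeff_prod_linFactor_zpow`): the variable `x_0` occurs in `L_0` only, and once it
has been extracted, `L_0` may be replaced by `L_1`, so that the next variable occurs in one factor
only.
-/

/-! ### Derivations at units and Lagrange inversion -/

open PowerSeries in
/-- A power series in `X` splits into its terms of degree at most `n` and a multiple of
`X ^ (n + 1)`. -/
theorem PowerSeries.exists_eq_sum_add_X_pow_mul {R : Type*} [CommRing R] (F : R⟦X⟧) (n : ℕ) :
    ∃ G : R⟦X⟧, F = ∑ m ∈ Finset.range (n + 1), C (coeff m F) * X ^ m + X ^ (n + 1) * G := by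
  have h : (X : R⟦X⟧) ^ (n + 1) ∣ F - ∑ m ∈ Finset.range (n + 1), C (coeff m F) * X ^ m := by
    rw [X_pow_dvd_iff]
    intro m hm
    simp only [map_sub, map_sum, coeff_C_mul, coeff_X_pow]
    rw [Finset.sum_eq_single m]
    · simp
    · intro b _ hb
      simp [Ne.symm hb]
    · intro h
      simp at h
      omega
  obtain ⟨G, hG⟩ := h
  exact ⟨G, by rw [← hG]; ring⟩

section Units

variable {S A : Type*} [CommRing S] [CommRing A] [Algebra S A]

theorem Derivation.leibniz_units_inv (D : Derivation S A A) (u : Aˣ) :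
    D (↑u⁻¹ : A) = -((↑u⁻¹ : A) ^ 2 * D (u : A)) := by
  have := D.leibniz_of_mul_eq_one (a := (↑u⁻¹ : A)) (b := u) (by simp)
  simpa using this

theorem Derivation.leibniz_units_zpow (D : Derivation S A A) (u : Aˣ) (e : ℤ) :
    D (↑(u ^ e) : A) = (e : A) * (↑(u ^ (e - 1)) : A) * D (u : A) := by
  have hpos : ∀ n : ℕ, D (↑(u ^ (n : ℤ)) : A)
      = (n : A) * (↑(u ^ ((n : ℤ) - 1)) : A) * D (u : A) := by
    intro n
    rcases n with _ | n
    · simp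
    · have h1 : ((n + 1 : ℕ) : ℤ) - 1 = (n : ℤ) := by push_cast; ring
      rw [h1]
      simp only [zpow_natCast, Units.val_pow_eq_pow_val, Derivation.leibniz_pow]
      simp [nsmul_eq_mul, mul_assoc]
  obtain ⟨n, rfl | rfl⟩ := e.eq_nat_or_neg
  · simpa using hpos n
  · rw [zpow_neg, D.leibniz_units_inv, hpos]
    have h : (↑(u ^ (-(n : ℤ) - 1)) : A)
        = (↑(u ^ (n : ℤ))⁻¹ : A) ^ 2 * (↑(u ^ ((n : ℤ) - 1)) : A) := by
      rw [← Units.val_pow_eq_pow_val, ← Units.val_mul]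
      congr 1
      rw [← zpow_neg, ← zpow_natCast, ← zpow_mul, ← zpow_add]
      congr 1
      push_cast
      ring
    rw [h]
    push_cast
    ring

end Units

section Lagrange

open PowerSeries

variable {R : Type*} [CommRing R]

/-- The series `X / φ`, for an invertible power series `φ`; its inverse under substitution is the
solution `y` of `y = X * φ(y)`. -/
noncomputable def divUnit (φ : R⟦X⟧ˣ) : R⟦X⟧ := X * (↑φ⁻¹ : R⟦X⟧)

theorem hasSubst_divUnit (φ : R⟦X⟧ˣ) : HasSubst (divUnit φ) := by
  apply HasSubst.of_constantCoeff_zero'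
  simp [divUnit]

/-- Substitution of `X / φ` for `X`, as a ring homomorphism. -/
noncomputable def substDivUnit (φ : R⟦X⟧ˣ) : R⟦X⟧ →+* R⟦X⟧ :=
  (substAlgHom (R := R) (hasSubst_divUnit φ) : R⟦X⟧ →ₐ[R] R⟦X⟧)

theorem substDivUnit_X (φ : R⟦X⟧ˣ) : substDivUnit φ X = divUnit φ :=
  substAlgHom_X (hasSubst_divUnit φ)

theorem substDivUnit_C (φ : R⟦X⟧ˣ) (r : R) : substDivUnit φ (C r) = C r :=
  (substAlgHom (R := R) (hasSubst_divUnit φ)).commutes r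

theorem constantCoeff_substDivUnit (φ : R⟦X⟧ˣ) (F : R⟦X⟧) (hF : constantCoeff F = 0) :
    constantCoeff (substDivUnit φ F) = 0 := by
  obtain ⟨G, rfl⟩ := X_dvd_iff.mpr hF
  simp [substDivUnit_X, divUnit]

/-- The residue computation behind Lagrange inversion: a power of `X / φ` is orthogonal to all but
one power of `φ / X`. -/
theorem coeff_derivative_divUnit_pow_mul (φ : R⟦X⟧ˣ) [Algebra ℚ R] {m n : ℕ} (hmn : m ≤ n + 1) :
    coeff n (d⁄dX R (divUnit φ ^ m) * (φ : R⟦X⟧) ^ (n + 1))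
      = if m = n + 1 then (n + 1 : R) else 0 := by
  obtain ⟨p, hp⟩ := Nat.exists_eq_add_of_le hmn
  have key : d⁄dX R (divUnit φ ^ m) * (φ : R⟦X⟧) ^ (n + 1)
      = (m : R⟦X⟧) * (X ^ (m - 1) * (φ : R⟦X⟧) ^ p)
        - (m : R⟦X⟧) * (X ^ m * ((φ : R⟦X⟧) ^ p * (↑φ⁻¹ : R⟦X⟧) * d⁄dX R (φ : R⟦X⟧))) := by
    have hd : d⁄dX R (divUnit φ)
        = (↑φ⁻¹ : R⟦X⟧) - X * (↑φ⁻¹ : R⟦X⟧) ^ 2 * d⁄dX R (φ : R⟦X⟧) := by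
      rw [divUnit, Derivation.leibniz, Derivation.leibniz_units_inv, derivative_X]
      simp
      ring
    rw [Derivation.leibniz_pow, hd, hp]
    rcases m with _ | m
    · simp
    · have hinv : (↑φ⁻¹ : R⟦X⟧) ^ (m + 1) * (φ : R⟦X⟧) ^ (m + 1) = 1 := by
        rw [← mul_pow]; simp
      simp only [divUnit, mul_pow, Nat.add_sub_cancel, smul_eq_mul, nsmul_eq_mul]
      linear_combination ((m + 1 : ℕ) : R⟦X⟧) * (X ^ m * (φ : R⟦X⟧) ^ p
        - X ^ (m + 1) * ((φ : R⟦X⟧) ^ p * (↑φ⁻¹ : R⟦X⟧) * d⁄dX R (φ : R⟦X⟧))) * hinv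
  rcases p with _ | p
  · obtain rfl : m = n + 1 := by omega
    rw [key, if_pos rfl, map_sub]
    have h1 : coeff n (((n + 1 : ℕ) : R⟦X⟧) * (X ^ (n + 1 - 1) * (φ : R⟦X⟧) ^ 0))
        = (n + 1 : R) := by
      rw [← nsmul_eq_mul, map_nsmul]
      simp
    have h2 : coeff n (((n + 1 : ℕ) : R⟦X⟧) *
        (X ^ (n + 1) * ((φ : R⟦X⟧) ^ 0 * (↑φ⁻¹ : R⟦X⟧) * d⁄dX R (φ : R⟦X⟧)))) = 0 := by
      rw [← nsmul_eq_mul, map_nsmul, coeff_X_pow_mul']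
      simp
    rw [h1, h2, sub_zero]
  · rw [if_neg (by omega), key]
    -- the second term is a multiple of the derivative of `φ ^ (p + 1)`
    have hφ : d⁄dX R ((φ : R⟦X⟧) ^ (p + 1))
        = ((p + 1 : ℕ) : R⟦X⟧) * ((φ : R⟦X⟧) ^ (p + 1) * (↑φ⁻¹ : R⟦X⟧) * d⁄dX R (φ : R⟦X⟧)) := by
      rw [Derivation.leibniz_pow, pow_succ, mul_assoc ((φ : R⟦X⟧) ^ p)]
      simp
    have hreg : IsUnit ((p + 1 : ℕ) : R) := by
      have : IsUnit ((p + 1 : ℕ) : ℚ) := by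
        rw [isUnit_iff_ne_zero]; positivity
      simpa using this.map (algebraMap ℚ R)
    rcases m with _ | m
    · simp
    · obtain rfl : n = m + (p + 1) := by omega
      have hc := congrArg (coeff p) hφ
      rw [coeff_derivative, ← nsmul_eq_mul, map_nsmul, nsmul_eq_mul] at hc
      have hc' : coeff p ((φ : R⟦X⟧) ^ (p + 1) * (↑φ⁻¹ : R⟦X⟧) * d⁄dX R (φ : R⟦X⟧))
          = coeff (p + 1) ((φ : R⟦X⟧) ^ (p + 1)) := by
        apply hreg.mul_left_cancel
        rw [← hc]
        push_cast
        ring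
      rw [map_sub, ← nsmul_eq_mul, ← nsmul_eq_mul, map_nsmul, map_nsmul, Nat.add_sub_cancel,
        add_comm m (p + 1), coeff_X_pow_mul, show p + 1 + m = p + (m + 1) by ring, coeff_X_pow_mul,
        hc', sub_self]

/-- Lagrange inversion. If `F` is expanded in powers of `X / φ`, its coefficients are read off from
`F(X / φ)` without inverting the substitution. -/
theorem succ_mul_coeff_eq_coeff_derivative_substDivUnit [Algebra ℚ R] (φ : R⟦X⟧ˣ) (F : R⟦X⟧)
    (n : ℕ) :
    (n + 1 : R) * coeff (n + 1) F
      = coeff n (d⁄dX R (substDivUnit φ F) * (φ : R⟦X⟧) ^ (n + 1)) := by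
  obtain ⟨G, hG⟩ := F.exists_eq_sum_add_X_pow_mul (n + 1)
  have hσ : substDivUnit φ F = ∑ m ∈ Finset.range (n + 2), C (coeff m F) * divUnit φ ^ m
      + X ^ (n + 2) * ((↑φ⁻¹ : R⟦X⟧) ^ (n + 2) * substDivUnit φ G) := by
    conv_lhs => rw [hG]
    simp only [map_add, map_sum, map_mul, map_pow, substDivUnit_X, substDivUnit_C]
    rw [show divUnit φ ^ (n + 1 + 1) = X ^ (n + 2) * (↑φ⁻¹ : R⟦X⟧) ^ (n + 2) by
      rw [divUnit, mul_pow]]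
    ring
  rw [hσ, map_add, add_mul (d⁄dX R _), map_add, map_sum, Finset.sum_mul, map_sum]
  -- the remainder is divisible by `X ^ (n + 2)`, its derivative still by `X ^ (n + 1)`
  have hrem : coeff n (d⁄dX R (X ^ (n + 2) * ((↑φ⁻¹ : R⟦X⟧) ^ (n + 2) * substDivUnit φ G))
      * (φ : R⟦X⟧) ^ (n + 1)) = 0 := by
    rw [Derivation.leibniz, Derivation.leibniz_pow, derivative_X]
    simp only [smul_eq_mul, nsmul_eq_mul, mul_one]
    generalize (↑φ⁻¹ : R⟦X⟧) ^ (n + 2) * substDivUnit φ G = H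
    have : (X ^ (n + 2) * d⁄dX R H + H * (((n + 2 : ℕ) : R⟦X⟧) * X ^ (n + 2 - 1)))
          * (φ : R⟦X⟧) ^ (n + 1)
        = X ^ (n + 1) * ((X * d⁄dX R H + H * ((n + 2 : ℕ) : R⟦X⟧)) * (φ : R⟦X⟧) ^ (n + 1)) := by
      rw [show n + 2 - 1 = n + 1 by omega]
      ring
    rw [this, coeff_X_pow_mul']
    simp
  rw [hrem, add_zero, Finset.sum_eq_single (n + 1)]
  · rw [Derivation.leibniz, derivative_C, smul_zero, add_zero, smul_eq_mul, mul_assoc, coeff_C_mul,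
      coeff_derivative_divUnit_pow_mul φ le_rfl, if_pos rfl, mul_comm]
  · intro m hm hne
    have hm' := Finset.mem_range.mp hm
    rw [Derivation.leibniz, derivative_C, smul_zero, add_zero, smul_eq_mul, mul_assoc, coeff_C_mul,
      coeff_derivative_divUnit_pow_mul φ (by omega), if_neg hne, mul_zero]
  · intro h
    simp at h

end Lagrange

/-! ### The linear factors and their alternating products -/

section Algebra

open PowerSeries

/-- The derivation of `ℚ[x₀, x₁, …]⟦X⟧` that differentiates each coefficient with respect to
`x j`. -/
noncomputable def coeffPderiv (j : ℕ) :
    Derivation ℚ (MvPolynomial ℕ ℚ)⟦X⟧ (MvPolynomial ℕ ℚ)⟦X⟧ :=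
  Derivation.mk'
    { toFun := fun F => PowerSeries.mk fun n => MvPolynomial.pderiv j (coeff n F)
      map_add' := fun F G => by ext n : 1; simp
      map_smul' := fun c F => by
        ext n : 1
        simp }
    (fun F G => by
      ext n : 1
      simp only [LinearMap.coe_mk, AddHom.coe_mk, coeff_mk, smul_eq_mul, map_add, coeff_mul,
        map_sum, Derivation.leibniz, Finset.sum_add_distrib]
      congr 1
      exact Finset.Nat.sum_antidiagonal_swap.symm)

theorem coeff_coeffPderiv (j n : ℕ) (F : (MvPolynomial ℕ ℚ)⟦X⟧) :
    coeff n (coeffPderiv j F) = MvPolynomial.pderiv j (coeff n F) := by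
  simp [coeffPderiv]

theorem coeffPderiv_C (j : ℕ) (r : MvPolynomial ℕ ℚ) :
    coeffPderiv j (C r) = C (MvPolynomial.pderiv j r) := by
  ext n : 1
  rw [coeff_coeffPderiv, coeff_C, coeff_C]
  split_ifs <;> simp

theorem coeffPderiv_X (j : ℕ) : coeffPderiv j X = 0 := by
  ext n : 1
  rw [coeff_coeffPderiv, coeff_X]
  split_ifs <;> simp

/-- The alternating tail `∑_{i ≤ j < k} (-1) ^ j x j`. -/
noncomputable def altTail (k i : ℕ) : MvPolynomial ℕ ℚ :=
  ∑ j ∈ Finset.Ico i k, (-1) ^ j * MvPolynomial.X j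

theorem altTail_eq_add {k i : ℕ} (h : i < k) :
    altTail k i = (-1) ^ i * MvPolynomial.X i + altTail k (i + 1) :=
  Finset.sum_eq_sum_Ico_succ_bot h _

theorem altTail_self (k : ℕ) : altTail k k = 0 := by
  simp [altTail]

theorem pderiv_altTail (k i j : ℕ) :
    MvPolynomial.pderiv j (altTail k i) = if i ≤ j ∧ j < k then (-1) ^ j else 0 := by
  simp only [altTail, map_sum, Derivation.leibniz, MvPolynomial.pderiv_X, Derivation.leibniz_pow,
    Derivation.map_neg, Derivation.map_one_eq_zero, smul_eq_mul, neg_zero, mul_zero, smul_zero,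
    add_zero, Pi.single_apply]
  simp

theorem isUnit_one_add_X_mul_C (r : MvPolynomial ℕ ℚ) : IsUnit (1 + X * C r) := by
  rw [PowerSeries.isUnit_iff_constantCoeff]
  simp

/-- The linear factor `1 + X ∑_{i ≤ j < k} (-1) ^ j x j`, as an invertible power series. -/
noncomputable def linFactor (k i : ℕ) : (MvPolynomial ℕ ℚ)⟦X⟧ˣ :=
  (isUnit_one_add_X_mul_C (altTail k i)).unit

theorem val_linFactor (k i : ℕ) :
    (linFactor k i : (MvPolynomial ℕ ℚ)⟦X⟧) = 1 + X * C (altTail k i) := rfl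

theorem linFactor_self (k : ℕ) : linFactor k k = 1 := by
  ext1
  simp [val_linFactor, altTail_self]

theorem linFactor_eq_add {k i : ℕ} (h : i < k) :
    (linFactor k i : (MvPolynomial ℕ ℚ)⟦X⟧)
      = (linFactor k (i + 1) : (MvPolynomial ℕ ℚ)⟦X⟧)
        + (-1) ^ i * (X * C (MvPolynomial.X i)) := by
  rw [val_linFactor, val_linFactor, altTail_eq_add h]
  simp
  ring

theorem coeffPderiv_linFactor (k i j : ℕ) :
    coeffPderiv j (linFactor k i : (MvPolynomial ℕ ℚ)⟦X⟧)
      = if i ≤ j ∧ j < k then (-1) ^ j * X else 0 := by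
  rw [val_linFactor, map_add, Derivation.map_one_eq_zero, Derivation.leibniz, coeffPderiv_C,
    coeffPderiv_X, pderiv_altTail]
  split_ifs <;> simp [mul_comm]

/-- The alternating product `∏_{i < j} (linFactor k i) ^ (-1) ^ i`. -/
noncomputable def altProd (k j : ℕ) : (MvPolynomial ℕ ℚ)⟦X⟧ˣ :=
  ∏ i ∈ Finset.range j, linFactor k i ^ ((-1 : ℤ) ^ i)

theorem altProd_zero (k : ℕ) : altProd k 0 = 1 := by simp [altProd]

theorem altProd_succ_of_even (k : ℕ) {j : ℕ} (hj : Even j) :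
    altProd k (j + 1) = altProd k j * linFactor k j := by
  rw [altProd, Finset.prod_range_succ, hj.neg_one_pow, zpow_one, altProd]

theorem altProd_succ_of_odd (k : ℕ) {j : ℕ} (hj : Odd j) :
    altProd k (j + 1) = altProd k j * (linFactor k j)⁻¹ := by
  rw [altProd, Finset.prod_range_succ, hj.neg_one_pow, zpow_neg_one, altProd]

theorem altProd_succ_self (k : ℕ) : altProd k (k + 1) = altProd k k := by
  rw [altProd, Finset.prod_range_succ, linFactor_self, one_zpow, mul_one, altProd]

/-- The derivation `X² d/dX + (-1) ^ j d/dx_j`. It maps every linear factor `L` that involves `x j`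
to `X * L`. -/
noncomputable def eulerPderiv (j : ℕ) : Derivation ℚ (MvPolynomial ℕ ℚ)⟦X⟧ (MvPolynomial ℕ ℚ)⟦X⟧ :=
  (X : (MvPolynomial ℕ ℚ)⟦X⟧) ^ 2 • (derivative (MvPolynomial ℕ ℚ)).restrictScalars ℚ
    + ((-1) ^ j : (MvPolynomial ℕ ℚ)⟦X⟧) • coeffPderiv j

theorem eulerPderiv_apply (j : ℕ) (F : (MvPolynomial ℕ ℚ)⟦X⟧) :
    eulerPderiv j F = X ^ 2 * derivative (MvPolynomial ℕ ℚ) F + (-1) ^ j * coeffPderiv j F := rfl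

theorem eulerPderiv_linFactor {k i j : ℕ} (hij : i ≤ j) (hj : j < k) :
    eulerPderiv j (linFactor k i : (MvPolynomial ℕ ℚ)⟦X⟧) =
      X * (linFactor k i : (MvPolynomial ℕ ℚ)⟦X⟧) := by
  rw [eulerPderiv_apply, coeffPderiv_linFactor, if_pos ⟨hij, hj⟩, val_linFactor, map_add,
    Derivation.map_one_eq_zero, Derivation.leibniz, derivative_C, derivative_X]
  simp only [smul_eq_mul, mul_one]
  have : ((-1 : (MvPolynomial ℕ ℚ)⟦X⟧) ^ j) * (-1) ^ j = 1 := by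
    rw [← mul_pow]; simp
  linear_combination X * this

/-- For `i ≤ j + 1` all factors of `altProd k i` involve `x j`, so that `eulerPderiv j` multiplies it
by `X` times the sum of their exponents. Its derivatives with respect to `X` and to `x j` thus
determine each other. -/
theorem eulerPderiv_altProd {k i j : ℕ} (hij : i ≤ j + 1) (hj : j < k) :
    eulerPderiv j (altProd k i : (MvPolynomial ℕ ℚ)⟦X⟧) =
      ((i % 2 : ℕ) : (MvPolynomial ℕ ℚ)⟦X⟧) * X * (altProd k i : (MvPolynomial ℕ ℚ)⟦X⟧) := by
  induction i with
  | zero => simp [altProd_zero]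
  | succ i ih =>
    have h := eulerPderiv_linFactor (k := k) (i := i) (j := j) (by omega) hj
    rcases Nat.even_or_odd i with hi | hi
    · have h2 : i % 2 = 0 := Nat.even_iff.mp hi
      have h3 : (i + 1) % 2 = 1 := by omega
      rw [altProd_succ_of_even k hi, Units.val_mul, Derivation.leibniz, ih (by omega), h, h2, h3]
      simp
      ring
    · have h2 : i % 2 = 1 := Nat.odd_iff.mp hi
      have h3 : (i + 1) % 2 = 0 := by omega
      have hinv : (↑(linFactor k i)⁻¹ : (MvPolynomial ℕ ℚ)⟦X⟧) * linFactor k i = 1 := by simp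
      rw [altProd_succ_of_odd k hi, Units.val_mul, Derivation.leibniz, Derivation.leibniz_units_inv,
        ih (by omega), h, h2, h3]
      simp only [smul_eq_mul]
      push_cast
      linear_combination (-(altProd k i : (MvPolynomial ℕ ℚ)⟦X⟧) * X * ↑(linFactor k i)⁻¹) * hinv

theorem coeffPderiv_prod_linFactor_zpow_eq_zero (k j : ℕ) (s : Finset ℕ) (hs : ∀ i ∈ s, j < i)
    (e : ℕ → ℤ) :
    coeffPderiv j (↑(∏ i ∈ s, linFactor k i ^ e i) : (MvPolynomial ℕ ℚ)⟦X⟧) = 0 := by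
  induction s using Finset.induction_on with
  | empty => simp
  | insert a s ha ih =>
    have h1 : coeffPderiv j (linFactor k a : (MvPolynomial ℕ ℚ)⟦X⟧) = 0 := by
      rw [coeffPderiv_linFactor, if_neg]
      have := hs a (by simp)
      omega
    rw [Finset.prod_insert ha, Units.val_mul, Derivation.leibniz,
      ih fun i hi => hs i (Finset.mem_insert_of_mem hi), Derivation.leibniz_units_zpow, h1]
    simp

/-- The factors of `altProd k k` beyond the `j`-th do not involve `x j`, so that a power of
`altProd k k` differs from the same power of `altProd k (j + 1)` by a constant of `d/dx_j`. -/
theorem coeffPderiv_altProd_zpow_mul {k j : ℕ} (hj : j < k) (p q : ℤ) :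
    coeffPderiv j (↑(altProd k (j + 1) ^ p * altProd k k ^ q) : (MvPolynomial ℕ ℚ)⟦X⟧)
      = ((p + q : ℤ) : (MvPolynomial ℕ ℚ)⟦X⟧) * ↑(altProd k (j + 1) ^ (p - 1) * altProd k k ^ q)
        * coeffPderiv j (altProd k (j + 1) : (MvPolynomial ℕ ℚ)⟦X⟧) := by
  obtain ⟨W, hW, hsplit⟩ : ∃ W : (MvPolynomial ℕ ℚ)⟦X⟧ˣ,
      coeffPderiv j (W : (MvPolynomial ℕ ℚ)⟦X⟧) = 0 ∧ altProd k k = altProd k (j + 1) * W := by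
    refine ⟨∏ i ∈ Finset.Ico (j + 1) k, linFactor k i ^ ((-1 : ℤ) ^ i),
      coeffPderiv_prod_linFactor_zpow_eq_zero k j _ (fun i hi => ?_) _, ?_⟩
    · have := Finset.mem_Ico.mp hi
      omega
    · rw [altProd, altProd, Finset.prod_range_mul_prod_Ico _ (by omega)]
  have h1 : altProd k (j + 1) ^ p * altProd k k ^ q = altProd k (j + 1) ^ (p + q) * W ^ q := by
    rw [hsplit, mul_zpow, zpow_add, mul_assoc]
  have h2 : altProd k (j + 1) ^ (p - 1) * altProd k k ^ q
      = altProd k (j + 1) ^ (p + q - 1) * W ^ q := by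
    rw [hsplit, mul_zpow, ← mul_assoc, ← zpow_add]
    congr 2
    ring
  rw [h1, h2, Units.val_mul, Derivation.leibniz, Derivation.leibniz_units_zpow,
    Derivation.leibniz_units_zpow, hW, Units.val_mul]
  simp only [smul_eq_mul]
  ring

end Algebra

/-! ### Coefficients of products of powers of the linear factors -/

section Coefficients

open PowerSeries

/-- The coefficient of `x ^ m * X ^ |m|`, where `|m|` is the degree of the monomial `x ^ m`. -/
noncomputable def diagCoeff (m : ℕ →₀ ℕ) : (MvPolynomial ℕ ℚ)⟦X⟧ →+ ℚ where
  toFun F := MvPolynomial.coeff m (coeff m.degree F)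
  map_zero' := by simp
  map_add' F G := by simp

theorem diagCoeff_apply (m : ℕ →₀ ℕ) (F : (MvPolynomial ℕ ℚ)⟦X⟧) :
    diagCoeff m F = MvPolynomial.coeff m (coeff m.degree F) := rfl

theorem diagCoeff_intCast_mul (m : ℕ →₀ ℕ) (c : ℤ) (F : (MvPolynomial ℕ ℚ)⟦X⟧) :
    diagCoeff m ((c : (MvPolynomial ℕ ℚ)⟦X⟧) * F) = c * diagCoeff m F := by
  rw [← zsmul_eq_mul, map_zsmul, zsmul_eq_mul]

theorem diagCoeff_X_mul_C_X_mul {m : ℕ →₀ ℕ} {i : ℕ} (hm : m i = 0) (F : (MvPolynomial ℕ ℚ)⟦X⟧) :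
    diagCoeff m (X * C (MvPolynomial.X i) * F) = 0 := by
  rw [diagCoeff_apply, mul_assoc]
  rcases m.degree with _ | d
  · simp
  · rw [coeff_succ_X_mul, coeff_C_mul, MvPolynomial.coeff_X_mul', if_neg]
    simp [hm]

theorem succ_mul_diagCoeff_add_single {m : ℕ →₀ ℕ} {i : ℕ} {F : (MvPolynomial ℕ ℚ)⟦X⟧} :
    (m i + 1 : ℚ) * diagCoeff (m + Finsupp.single i 1) F
      = MvPolynomial.coeff m (coeff (m.degree + 1) (coeffPderiv i F)) := by
  rw [coeff_coeffPderiv, MvPolynomial.coeff_pderiv, diagCoeff_apply, map_add,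
    Finsupp.degree_single, mul_comm]

theorem diagCoeff_linFactor_zpow_mul_of_eq_zero {k i : ℕ} (hi : i < k) (E : ℤ)
    (G : (MvPolynomial ℕ ℚ)⟦X⟧) {m : ℕ →₀ ℕ} (hm : m i = 0) :
    diagCoeff m (↑(linFactor k i ^ E) * G) = diagCoeff m (↑(linFactor k (i + 1) ^ E) * G) := by
  -- the two linear factors are congruent modulo `X * x i`, hence so are their powers
  obtain ⟨H, hH⟩ : X * C (MvPolynomial.X i) ∣
      (↑(linFactor k i ^ E) - ↑(linFactor k (i + 1) ^ E) : (MvPolynomial ℕ ℚ)⟦X⟧) := by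
    have hpos : ∀ n : ℕ, X * C (MvPolynomial.X i) ∣
        (↑(linFactor k i ^ (n : ℤ)) - ↑(linFactor k (i + 1) ^ (n : ℤ)) :
          (MvPolynomial ℕ ℚ)⟦X⟧) := by
      intro n
      simp only [zpow_natCast, Units.val_pow_eq_pow_val]
      refine dvd_trans ?_ (sub_dvd_pow_sub_pow _ _ n)
      rw [linFactor_eq_add hi, add_sub_cancel_left]
      exact dvd_mul_left _ _
    obtain ⟨n, rfl | rfl⟩ := E.eq_nat_or_neg
    · exact hpos n
    · rw [zpow_neg, zpow_neg]
      have h := hpos n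
      generalize linFactor k i ^ (n : ℤ) = u at h ⊢
      generalize linFactor k (i + 1) ^ (n : ℤ) = v at h ⊢
      have huv : (↑u⁻¹ - ↑v⁻¹ : (MvPolynomial ℕ ℚ)⟦X⟧)
          = (↑u - ↑v : (MvPolynomial ℕ ℚ)⟦X⟧) * (-(↑u⁻¹ * ↑v⁻¹)) := by
        have hu : (↑u * ↑u⁻¹ : (MvPolynomial ℕ ℚ)⟦X⟧) = 1 := by simp
        have hv : (↑v * ↑v⁻¹ : (MvPolynomial ℕ ℚ)⟦X⟧) = 1 := by simp
        linear_combination (↑v⁻¹ : (MvPolynomial ℕ ℚ)⟦X⟧) * hu - (↑u⁻¹ : (MvPolynomial ℕ ℚ)⟦X⟧) * hv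
      rw [huv]
      exact Dvd.dvd.mul_right h _
  rw [← sub_eq_zero, ← map_sub, ← sub_mul, hH, mul_assoc (X * C _), diagCoeff_X_mul_C_X_mul hm]

/-- The variable `x i` is extracted from a power of the first linear factor that involves it, all
other factors being free of it. -/
theorem diagCoeff_linFactor_zpow_mul {k i : ℕ} (hi : i < k) (E : ℤ)
    (G : (MvPolynomial ℕ ℚ)⟦X⟧) (hG : coeffPderiv i G = 0) (m : ℕ →₀ ℕ) :
    diagCoeff m (↑(linFactor k i ^ E) * G) = (-1) ^ (i * m i) * (Ring.choose E (m i) : ℤ)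
      * diagCoeff (m.erase i) (↑(linFactor k (i + 1) ^ (E - m i)) * G) := by
  induction h : m i generalizing m E with
  | zero =>
    rw [diagCoeff_linFactor_zpow_mul_of_eq_zero hi E G h, Finsupp.erase_of_notMem_support]
    · simp
    · simpa using h
  | succ a ih =>
    obtain ⟨m', rfl⟩ : ∃ m', m = m' + Finsupp.single i 1 := by
      refine ⟨m - Finsupp.single i 1, (tsub_add_cancel_of_le ?_).symm⟩
      rw [Finsupp.single_le_iff]
      omega
    have ha : m' i = a := by simpa using h
    have hD : coeffPderiv i (↑(linFactor k i ^ E) * G)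
        = X * ((((-1) ^ i * E : ℤ) : (MvPolynomial ℕ ℚ)⟦X⟧)
          * ((↑(linFactor k i ^ (E - 1)) : (MvPolynomial ℕ ℚ)⟦X⟧) * G)) := by
      rw [Derivation.leibniz, hG, Derivation.leibniz_units_zpow, coeffPderiv_linFactor,
        if_pos ⟨le_rfl, hi⟩]
      simp only [smul_eq_mul]
      push_cast
      ring
    have h1 := succ_mul_diagCoeff_add_single (m := m') (i := i) (F := ↑(linFactor k i ^ E) * G)
    rw [hD, coeff_succ_X_mul, ← diagCoeff_apply, diagCoeff_intCast_mul, ih (E - 1) m' ha, ha] at h1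
    have hchoose : ((a + 1 : ℕ) : ℤ) * Ring.choose E (a + 1) = E * Ring.choose (E - 1) a := by
      have := Ring.choose_smul_choose E (n := a + 1) (k := 1) (by omega)
      simpa [Ring.choose_one_right] using this
    have hchoose' : (a + 1 : ℚ) * (Ring.choose E (a + 1) : ℤ)
        = E * (Ring.choose (E - 1) a : ℤ) := by
      exact_mod_cast hchoose
    have herase : (m' + Finsupp.single i 1).erase i = m'.erase i := by
      rw [Finsupp.erase_add]
      simp
    have hE : E - 1 - (a : ℤ) = E - ((a + 1 : ℕ) : ℤ) := by
      push_cast; ring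
    rw [herase, ← hE]
    have hne : (a + 1 : ℚ) ≠ 0 := by positivity
    apply mul_left_cancel₀ hne
    rw [h1]
    push_cast
    rw [show i * (a + 1) = i + i * a by ring, pow_add]
    linear_combination (-((-1) ^ i * (-1) ^ (i * a)
      * diagCoeff (m'.erase i) (↑(linFactor k (i + 1) ^ (E - 1 - (a : ℤ))) * G))) * hchoose'

theorem diagCoeff_linFactor_zpow_mul_prod_Ico (k d i : ℕ) (hd : i + d = k) (e : ℕ → ℤ) (E : ℤ)
    (m : ℕ →₀ ℕ) (hm : ∀ j, m j ≠ 0 → i ≤ j ∧ j < k) :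
    diagCoeff m ↑(linFactor k i ^ E * ∏ j ∈ Finset.Ico (i + 1) (k + 1), linFactor k j ^ e j)
      = ∏ j ∈ Finset.Ico i k, ((-1) ^ (j * m j) *
          (Ring.choose (E + ∑ t ∈ Finset.Ico (i + 1) (j + 1), e t - ∑ t ∈ Finset.Ico i j, (m t : ℤ))
            (m j) : ℤ) : ℚ) := by
  induction d generalizing i E m with
  | zero =>
    obtain rfl : i = k := by omega
    have : m = 0 := by
      ext j
      by_contra h
      have := hm j h
      omega
    subst this
    simp [linFactor_self, diagCoeff_apply]
  | succ d ih =>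
    have hi : i < k := by omega
    rw [Units.val_mul, diagCoeff_linFactor_zpow_mul hi _ _
      (coeffPderiv_prod_linFactor_zpow_eq_zero k i _ (fun j hj => by
        have := Finset.mem_Ico.mp hj
        omega) e)]
    have hsplit : linFactor k (i + 1) ^ (E - m i)
          * ∏ j ∈ Finset.Ico (i + 1) (k + 1), linFactor k j ^ e j
        = linFactor k (i + 1) ^ (E - m i + e (i + 1))
          * ∏ j ∈ Finset.Ico (i + 1 + 1) (k + 1), linFactor k j ^ e j := by
      rw [Finset.prod_eq_prod_Ico_succ_bot (by omega : i + 1 < k + 1), zpow_add, mul_assoc]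
    rw [← Units.val_mul, hsplit, ih (i + 1) (by omega) _ (m.erase i) (fun j hj => by
      by_cases hji : j = i
      · simp [hji] at hj
      · rw [Finsupp.erase_ne hji] at hj
        have := hm j hj
        omega)]
    rw [Finset.prod_eq_prod_Ico_succ_bot hi]
    congr 1
    · simp
    · refine Finset.prod_congr rfl fun j hj => ?_
      have hj' := Finset.mem_Ico.mp hj
      have hsum : ∑ t ∈ Finset.Ico (i + 1) j, ((m.erase i) t : ℤ)
          = ∑ t ∈ Finset.Ico (i + 1) j, (m t : ℤ) := by
        refine Finset.sum_congr rfl fun t ht => ?_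
        have := Finset.mem_Ico.mp ht
        rw [Finsupp.erase_ne (by omega)]
      rw [hsum, Finsupp.erase_ne (by omega), Finset.sum_eq_sum_Ico_succ_bot (by omega : i < j),
        Finset.sum_eq_sum_Ico_succ_bot (by omega : i + 1 < j + 1)]
      congr 3
      ring

/-- Coefficients of a product of powers of the linear factors: each variable contributes one
binomial coefficient, whose upper entry is the total exponent of the factors that involve the
variable, reduced by what the preceding variables have used up. -/
theorem diagCoeff_prod_linFactor_zpow (k : ℕ) (e : ℕ → ℤ) (m : ℕ →₀ ℕ) (hm : ∀ j, m j ≠ 0 → j < k) :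
    diagCoeff m ↑(∏ j ∈ Finset.range (k + 1), linFactor k j ^ e j)
      = ∏ j ∈ Finset.range k, ((-1) ^ (j * m j) *
          (Ring.choose (∑ t ∈ Finset.range (j + 1), e t - ∑ t ∈ Finset.range j, (m t : ℤ))
            (m j) : ℤ) : ℚ) := by
  have h := diagCoeff_linFactor_zpow_mul_prod_Ico k k 0 (by simp) e (e 0) m
    (fun j hj => ⟨by simp, hm j hj⟩)
  rw [Finset.range_eq_Ico, Finset.prod_eq_prod_Ico_succ_bot (by omega : 0 < k + 1), h,
    Finset.range_eq_Ico]
  refine Finset.prod_congr rfl fun j _ => ?_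
  rw [Finset.range_eq_Ico, Finset.sum_eq_sum_Ico_succ_bot (by omega : 0 < j + 1),
    Finset.range_eq_Ico]

theorem altProd_zpow_mul_altProd_zpow (k j : ℕ) (hj : j ≤ k) (p q : ℤ) :
    altProd k j ^ p * altProd k k ^ q
      = ∏ i ∈ Finset.range (k + 1),
          linFactor k i ^ ((-1) ^ i * ((if i < j then p else 0) + q)) := by
  rw [← altProd_succ_self, altProd, altProd, ← Finset.prod_zpow, ← Finset.prod_zpow]
  simp_rw [mul_add, zpow_add, Finset.prod_mul_distrib, ← zpow_mul]
  congr 1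
  rw [← Finset.prod_range_mul_prod_Ico _ (by omega : j ≤ k + 1),
    Finset.prod_eq_one (s := Finset.Ico _ _), mul_one]
  · refine Finset.prod_congr rfl fun i hi => ?_
    rw [if_pos (Finset.mem_range.mp hi)]
  · intro i hi
    have := Finset.mem_Ico.mp hi
    rw [if_neg (by omega), mul_zero, zpow_zero]

theorem sum_range_neg_one_pow_mul (j : ℕ) (p q : ℤ) (t : ℕ) :
    ∑ i ∈ Finset.range t, (-1 : ℤ) ^ i * ((if i < j then p else 0) + q)
      = ((min t j % 2 : ℕ) : ℤ) * p + ((t % 2 : ℕ) : ℤ) * q := by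
  induction t with
  | zero => simp
  | succ t ih =>
    rw [Finset.sum_range_succ, ih]
    rcases Nat.even_or_odd t with h | h
    · have h2 : t % 2 = 0 := Nat.even_iff.mp h
      have h3 : (t + 1) % 2 = 1 := by omega
      rw [h.neg_one_pow, h2, h3]
      split_ifs with hj
      · have h4 : min t j % 2 = 0 := by rw [min_eq_left hj.le, h2]
        have h5 : min (t + 1) j % 2 = 1 := by rw [min_eq_left hj, h3]
        rw [h4, h5]; push_cast; ring
      · rw [min_eq_right (by omega), min_eq_right (by omega)]; push_cast; ring
    · have h2 : t % 2 = 1 := Nat.odd_iff.mp h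
      have h3 : (t + 1) % 2 = 0 := by omega
      rw [h.neg_one_pow, h2, h3]
      split_ifs with hj
      · have h4 : min t j % 2 = 1 := by rw [min_eq_left hj.le, h2]
        have h5 : min (t + 1) j % 2 = 0 := by rw [min_eq_left hj, h3]
        rw [h4, h5]; push_cast; ring
      · rw [min_eq_right (by omega), min_eq_right (by omega)]; push_cast; ring

end Coefficients

/-! ### Plane trees and their generating functions -/

namespace PlaneTree

theorem numVertices_pos {α : Type} (T : PlaneTree α) : 0 < T.numVertices := by
  cases T
  simp [numVertices, labels]

/-- Attach a tree to the root of another one, as the new first branch. Every tree with more than one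
vertex arises in exactly one way. -/
def graft {α : Type} (t : PlaneTree α) : PlaneTree α → PlaneTree α
  | node a ts => node a (t :: ts)

theorem rootLabel_graft {α : Type} (t s : PlaneTree α) : (graft t s).rootLabel = s.rootLabel := by
  cases s
  rfl

theorem labels_graft_perm {α : Type} (t s : PlaneTree α) :
    (graft t s).labels.Perm (t.labels ++ s.labels) := by
  obtain ⟨a, ts⟩ := s
  simpa [graft, labels] using List.perm_middle.symm

theorem numVertices_graft {α : Type} (t s : PlaneTree α) :
    (graft t s).numVertices = t.numVertices + s.numVertices := by
  simpa [numVertices] using (labels_graft_perm t s).length_eq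

theorem graft_inj {α : Type} {t t' s s' : PlaneTree α} (h : graft t s = graft t' s') :
    t = t' ∧ s = s' := by
  obtain ⟨a, ts⟩ := s
  obtain ⟨a', ts'⟩ := s'
  simp only [graft, node.injEq, List.cons.injEq] at h
  obtain ⟨rfl, rfl, rfl⟩ := h
  exact ⟨rfl, rfl⟩

theorem isKPlane_graft_iff {k : ℕ} {t s : PlaneTree ℕ} :
    IsKPlane k (graft t s) ↔
      IsKPlane k t ∧ IsKPlane k s ∧ s.rootLabel + t.rootLabel ≤ k + 1 := by
  obtain ⟨a, ts⟩ := s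
  constructor
  · rintro ⟨_, _, h1, h2, he, hb⟩
    exact ⟨hb t (by simp), ⟨a, ts, h1, h2, fun u hu => he u (by simp [hu]),
      fun u hu => hb u (by simp [hu])⟩, he t (by simp)⟩
  · rintro ⟨ht, ⟨_, _, h1, h2, he, hb⟩, hr⟩
    refine ⟨a, t :: ts, h1, h2, fun u hu => ?_, fun u hu => ?_⟩
    · rcases List.mem_cons.mp hu with rfl | hu
      · exact hr
      · exact he u hu
    · rcases List.mem_cons.mp hu with rfl | hu
      · exact ht
      · exact hb u hu

theorem IsKPlane.rootLabel_mem {k : ℕ} {T : PlaneTree ℕ} (h : IsKPlane k T) :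
    T.rootLabel ∈ Finset.Icc 1 k := by
  obtain ⟨a, ts, h1, h2, -, -⟩ := h
  exact Finset.mem_Icc.mpr ⟨h1, h2⟩

theorem eq_node_nil_or_eq_graft {α : Type} (T : PlaneTree α) :
    T = node T.rootLabel [] ∨ ∃ t s, T = graft t s := by
  obtain ⟨a, _ | ⟨t, ts⟩⟩ := T
  · exact Or.inl rfl
  · exact Or.inr ⟨t, node a ts, rfl⟩

theorem IsKPlane.labels_mem {k : ℕ} {T : PlaneTree ℕ} (h : IsKPlane k T) :
    ∀ a ∈ T.labels, a ∈ Finset.Icc 1 k := by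
  induction hn : T.numVertices using Nat.strong_induction_on generalizing T with
  | _ n ih =>
    rcases T.eq_node_nil_or_eq_graft with hT | ⟨t, s, rfl⟩
    · intro a ha
      rw [hT] at ha
      simp only [labels, List.flatMap_nil, List.mem_singleton] at ha
      rw [ha]
      exact h.rootLabel_mem
    · rw [numVertices_graft] at hn
      have ht := numVertices_pos t
      have hs := numVertices_pos s
      obtain ⟨h1, h2, -⟩ := isKPlane_graft_iff.mp h
      intro a ha
      rcases List.mem_append.mp ((labels_graft_perm t s).mem_iff.mp ha) with ha | ha
      · exact ih _ (by omega) h1 rfl a ha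
      · exact ih _ (by omega) h2 rfl a ha

/-- The `k`-plane trees with `n` vertices and root label `h`, with no condition on the other
labels. -/
def treesOfSize (k h n : ℕ) : Set (PlaneTree ℕ) :=
  {T | IsKPlane k T ∧ T.rootLabel = h ∧ T.numVertices = n}

theorem finite_treesOfSize (k h n : ℕ) : (treesOfSize k h n).Finite := by
  induction n using Nat.strong_induction_on generalizing h with
  | _ n ih =>
    have hsub : treesOfSize k h n ⊆ {node h []} ∪
        ⋃ p ∈ Finset.range n ×ˢ Finset.range n, ⋃ j ∈ Finset.Icc 1 k,
          Set.image2 graft (treesOfSize k j p.1) (treesOfSize k h p.2) := by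
      rintro T ⟨hT, hh, hn⟩
      rcases T.eq_node_nil_or_eq_graft with hT' | ⟨t, s, rfl⟩
      · left
        rw [hT', hh]
        rfl
      · right
        rw [numVertices_graft] at hn
        rw [rootLabel_graft] at hh
        have ht := numVertices_pos t
        have hs := numVertices_pos s
        obtain ⟨h1, h2, -⟩ := isKPlane_graft_iff.mp hT
        simp only [Set.mem_iUnion]
        refine ⟨(t.numVertices, s.numVertices), ?_, t.rootLabel, h1.rootLabel_mem,
          t, ⟨h1, rfl, rfl⟩, s, ⟨h2, hh, rfl⟩, rfl⟩
        simp only [Finset.mem_product, Finset.mem_range]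
        omega
    refine Set.Finite.subset ?_ hsub
    refine (Set.finite_singleton _).union ?_
    refine Set.Finite.biUnion (Finset.finite_toSet _) fun p hp => ?_
    simp only [Finset.coe_product, Set.mem_prod, Finset.coe_range, Set.mem_Iio] at hp
    exact Set.Finite.biUnion (Finset.finite_toSet _) fun j _ =>
      Set.Finite.image2 _ (ih _ hp.1 _) (ih _ hp.2 _)

/-- `treesOfSize` as a finset. -/
noncomputable def treeFinset (k h n : ℕ) : Finset (PlaneTree ℕ) :=
  (finite_treesOfSize k h n).toFinset

theorem mem_treeFinset {k h n : ℕ} {T : PlaneTree ℕ} :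
    T ∈ treeFinset k h n ↔ IsKPlane k T ∧ T.rootLabel = h ∧ T.numVertices = n := by
  simp [treeFinset, treesOfSize]

section GeneratingFunction

open PowerSeries

variable {R : Type*} [CommRing R]

/-- The product of the weights `x a` of the labels `a` of all vertices. -/
def weight {α : Type} (x : α → R) (T : PlaneTree α) : R := (T.labels.map x).prod

theorem weight_graft {α : Type} (x : α → R) (t s : PlaneTree α) :
    weight x (graft t s) = weight x t * weight x s := by
  rw [weight, ((labels_graft_perm t s).map x).prod_eq]
  simp [weight]

/-- The generating function of the `k`-plane trees with root label `h`: vertices are marked by `X`,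
and a vertex labelled `a` has weight `x a`. -/
noncomputable def treeSeries (k : ℕ) (x : ℕ → R) (h : ℕ) : R⟦X⟧ :=
  PowerSeries.mk fun n => ∑ T ∈ treeFinset k h n, weight x T

theorem coeff_treeSeries (k : ℕ) (x : ℕ → R) (h n : ℕ) :
    coeff n (treeSeries k x h) = ∑ T ∈ treeFinset k h n, weight x T := by
  simp [treeSeries]

theorem constantCoeff_treeSeries (k : ℕ) (x : ℕ → R) (h : ℕ) :
    constantCoeff (treeSeries k x h) = 0 := by
  rw [← coeff_zero_eq_constantCoeff_apply, coeff_treeSeries]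
  refine Finset.sum_eq_zero fun T hT => ?_
  have := (mem_treeFinset.mp hT).2.2
  have := T.numVertices_pos
  omega

/-- A tree is a single vertex or a tree with a first branch grafted on. -/
theorem treeSeries_eq (k : ℕ) (x : ℕ → R) {h : ℕ} (hh : h ∈ Finset.Icc 1 k) :
    treeSeries k x h = X * C (x h)
      + (∑ j ∈ Finset.Icc 1 (k + 1 - h), treeSeries k x j) * treeSeries k x h := by
  classical
  obtain ⟨h1, hk⟩ := Finset.mem_Icc.mp hh
  ext n : 1
  have hleaf : IsKPlane k (node h []) := ⟨h, [], h1, hk, by simp, by simp⟩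
  rw [coeff_treeSeries, ← Finset.sum_filter_add_sum_filter_not _ (fun T => T = node h []), map_add]
  congr 1
  · rw [coeff_mul_C, coeff_X, Finset.sum_filter, Finset.sum_ite_eq']
    have hmem : node h [] ∈ treeFinset k h n ↔ n = 1 := by
      rw [mem_treeFinset]
      simp [hleaf, rootLabel, numVertices, labels, eq_comm]
    by_cases hn : n = 1
    · rw [if_pos (hmem.mpr hn), if_pos hn]
      simp [weight, labels]
    · rw [if_neg (mt hmem.mp hn), if_neg hn]
      simp
  · rw [Finset.sum_mul, map_sum]
    simp_rw [coeff_mul, coeff_treeSeries, Finset.sum_mul_sum, ← Finset.sum_product']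
    rw [Finset.sum_sigma']
    symm
    refine Finset.sum_nbij (fun q => graft q.2.1 q.2.2) ?_ ?_ ?_ ?_
    · rintro ⟨⟨j, a, b⟩, t, s⟩ hq
      simp only [Finset.mem_sigma, Finset.mem_product, Finset.HasAntidiagonal.mem_antidiagonal,
        mem_treeFinset,
        Finset.mem_Icc] at hq
      obtain ⟨⟨⟨hj1, hj2⟩, hab⟩, ⟨ht, htj, hta⟩, hs, hsh, hsb⟩ := hq
      simp only [Finset.mem_filter, mem_treeFinset, isKPlane_graft_iff, rootLabel_graft,
        numVertices_graft]
      refine ⟨⟨⟨ht, hs, by omega⟩, hsh, by omega⟩, ?_⟩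
      obtain ⟨c, cs⟩ := s
      simp [graft]
    · rintro ⟨⟨j, a, b⟩, t, s⟩ hq ⟨⟨j', a', b'⟩, t', s'⟩ hq' heq
      simp only [Finset.coe_sigma, Set.mem_sigma_iff, Finset.mem_coe, Finset.mem_product,
        Finset.HasAntidiagonal.mem_antidiagonal, mem_treeFinset, Finset.mem_Icc] at hq hq'
      obtain ⟨rfl, rfl⟩ := graft_inj heq
      obtain ⟨-, ⟨-, rfl, rfl⟩, -, -, rfl⟩ := hq
      obtain ⟨-, ⟨-, rfl, rfl⟩, -, -, rfl⟩ := hq'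
      rfl
    · intro T hT
      simp only [Finset.mem_coe, Finset.mem_filter, mem_treeFinset] at hT
      obtain ⟨⟨hT, hTh, hTn⟩, hne⟩ := hT
      rcases T.eq_node_nil_or_eq_graft with hT' | ⟨t, s, rfl⟩
      · rw [hTh] at hT'
        exact absurd hT' hne
      · obtain ⟨ht, hs, hr⟩ := isKPlane_graft_iff.mp hT
        rw [rootLabel_graft] at hTh
        rw [numVertices_graft] at hTn
        have ht1 := Finset.mem_Icc.mp ht.rootLabel_mem
        refine ⟨⟨(t.rootLabel, t.numVertices, s.numVertices), t, s⟩, ?_, rfl⟩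
        simp only [Finset.coe_sigma, Set.mem_sigma_iff, Finset.mem_coe, Finset.mem_product,
          Finset.HasAntidiagonal.mem_antidiagonal, mem_treeFinset, Finset.mem_Icc]
        simp only [ht, hs, hTh, hTn, and_self, and_true]
        exact ⟨ht1.1, by omega⟩
    · rintro ⟨⟨j, a, b⟩, t, s⟩ -
      exact (weight_graft x t s).symm

end GeneratingFunction

end PlaneTree

/-! ### Solution of the equations of the generating functions -/

section Parametrisation

open PowerSeries

/-- The labels `1, …, k` are listed in the order `1, k, 2, k - 1, …`; this is the position of `a` in
that list, counted from `0`. -/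
def labelPos (k a : ℕ) : ℕ := if 2 * a ≤ k + 1 then 2 * a - 2 else 2 * (k - a) + 1

/-- The label at position `j` of the list `1, k, 2, k - 1, …`. -/
def labelAt (k j : ℕ) : ℕ := if j % 2 = 0 then j / 2 + 1 else k - j / 2

theorem labelPos_eq_iff {k a j : ℕ} (ha : a ∈ Finset.Icc 1 k) (hj : j < k) :
    labelPos k a = j ↔ a = labelAt k j := by
  have := Finset.mem_Icc.mp ha
  rw [labelPos, labelAt]
  split_ifs <;> omega

theorem labelPos_lt {k a : ℕ} (ha : a ∈ Finset.Icc 1 k) : labelPos k a < k := by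
  have := Finset.mem_Icc.mp ha
  rw [labelPos]
  split_ifs <;> omega

theorem labelAt_mem {k j : ℕ} (hj : j < k) : labelAt k j ∈ Finset.Icc 1 k := by
  rw [labelAt, Finset.mem_Icc]
  split_ifs <;> omega

theorem labelAt_labelPos {k a : ℕ} (ha : a ∈ Finset.Icc 1 k) : labelAt k (labelPos k a) = a :=
  ((labelPos_eq_iff ha (labelPos_lt ha)).mp rfl).symm

/-- The chain `v₀ = 1, v₁, …, v_{k + 1} = v_k` determined by `v_j * v_{j + 1} = L_j / φ`, where
`L_j` is the `j`-th linear factor and `φ` is the square of the full alternating product. -/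
noncomputable def chain (k j : ℕ) : (MvPolynomial ℕ ℚ)⟦X⟧ˣ :=
  if j % 2 = 0 then (altProd k j)⁻¹ else altProd k j * (altProd k k ^ 2)⁻¹

theorem chain_zero (k : ℕ) : chain k 0 = 1 := by simp [chain, altProd_zero]

theorem chain_of_even (k : ℕ) {j : ℕ} (hj : Even j) : chain k j = (altProd k j)⁻¹ :=
  if_pos (Nat.even_iff.mp hj)

theorem chain_of_odd (k : ℕ) {j : ℕ} (hj : Odd j) :
    chain k j = altProd k j * (altProd k k ^ 2)⁻¹ :=
  if_neg (by rw [Nat.odd_iff.mp hj]; simp)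

theorem chain_mul_chain_succ (k j : ℕ) :
    chain k j * chain k (j + 1) = linFactor k j * (altProd k k ^ 2)⁻¹ := by
  rcases Nat.even_or_odd j with h | h
  · rw [chain_of_even k h, chain_of_odd k h.add_one, altProd_succ_of_even k h]
    group
  · rw [chain_of_odd k h, chain_of_even k h.add_one, altProd_succ_of_odd k h, mul_inv, inv_inv]
    rw [mul_comm (altProd k j), mul_assoc, mul_inv_cancel_left, mul_comm]

theorem chain_succ_self (k : ℕ) : chain k (k + 1) = chain k k := by
  rcases Nat.even_or_odd k with h | h
  · rw [chain_of_even k h, chain_of_odd k h.add_one, altProd_succ_self]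
    group
  · rw [chain_of_odd k h, chain_of_even k h.add_one, altProd_succ_self]
    group

theorem chain_sub_mul_chain_succ {k j : ℕ} (hj : j < k) :
    ((chain k j : (MvPolynomial ℕ ℚ)⟦X⟧) - (chain k (j + 2) : (MvPolynomial ℕ ℚ)⟦X⟧))
        * (chain k (j + 1) : (MvPolynomial ℕ ℚ)⟦X⟧)
      = (-1) ^ j * (C (MvPolynomial.X j) * divUnit (altProd k k ^ 2)) := by
  have h1 := congrArg Units.val (chain_mul_chain_succ k j)
  have h2 := congrArg Units.val (chain_mul_chain_succ k (j + 1))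
  simp only [Units.val_mul] at h1 h2
  rw [linFactor_eq_add hj] at h1
  rw [divUnit]
  linear_combination h1 - h2

/-- The member of the chain that becomes one minus the generating function of the trees whose root
label is at most `a`. -/
noncomputable def complSeries (k a : ℕ) : (MvPolynomial ℕ ℚ)⟦X⟧ˣ :=
  chain k (if 2 * a ≤ k then 2 * a else 2 * (k - a) + 1)

theorem complSeries_sub_eq {k h : ℕ} (hh : h ∈ Finset.Icc 1 k) :
    complSeries k (k + 1 - h) = chain k (labelPos k h + 1) := by
  have := Finset.mem_Icc.mp hh
  rw [complSeries, labelPos]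
  congr 1
  split_ifs <;> omega

theorem complSeries_sub_mul {k h : ℕ} (hh : h ∈ Finset.Icc 1 k) :
    ((complSeries k (h - 1) : (MvPolynomial ℕ ℚ)⟦X⟧) - (complSeries k h : (MvPolynomial ℕ ℚ)⟦X⟧))
        * (complSeries k (k + 1 - h) : (MvPolynomial ℕ ℚ)⟦X⟧)
      = C (MvPolynomial.X (labelPos k h)) * divUnit (altProd k k ^ 2) := by
  have hh' := Finset.mem_Icc.mp hh
  have key := chain_sub_mul_chain_succ (labelPos_lt hh)
  rw [complSeries_sub_eq hh]
  rcases Nat.even_or_odd (labelPos k h) with he | ho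
  · have h1 : complSeries k (h - 1) = chain k (labelPos k h) := by
      rw [Nat.even_iff] at he
      rw [complSeries]
      congr 1
      rw [labelPos] at he ⊢
      split_ifs at he ⊢ <;> omega
    have h2 : complSeries k h = chain k (labelPos k h + 2) := by
      rw [Nat.even_iff] at he
      by_cases hk : 2 * h = k + 1
      · have e : labelPos k h + 2 = k + 1 := by
          rw [labelPos] at he ⊢
          split_ifs at he ⊢ <;> omega
        rw [e, chain_succ_self, complSeries]
        congr 1
        split_ifs <;> omega
      · rw [complSeries]
        congr 1
        rw [labelPos] at he ⊢
        split_ifs at he ⊢ <;> omega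
    rw [he.neg_one_pow, one_mul] at key
    rw [h1, h2, key]
  · have h1 : complSeries k h = chain k (labelPos k h) := by
      rw [Nat.odd_iff] at ho
      rw [complSeries]
      congr 1
      rw [labelPos] at ho ⊢
      split_ifs at ho ⊢ <;> omega
    have h2 : complSeries k (h - 1) = chain k (labelPos k h + 2) := by
      rw [Nat.odd_iff] at ho
      by_cases hk : 2 * (h - 1) = k
      · have e : labelPos k h + 2 = k + 1 := by
          rw [labelPos] at ho ⊢
          split_ifs at ho ⊢ <;> omega
        rw [e, chain_succ_self, complSeries]
        congr 1
        rw [if_pos hk.le, hk]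
      · rw [complSeries]
        congr 1
        rw [labelPos] at ho ⊢
        split_ifs at ho ⊢ <;> omega
    rw [ho.neg_one_pow] at key
    rw [h1, h2]
    linear_combination -key

theorem sum_complSeries_sub {k b : ℕ} :
    ∑ h ∈ Finset.Icc 1 b, ((complSeries k (h - 1) : (MvPolynomial ℕ ℚ)⟦X⟧)
        - (complSeries k h : (MvPolynomial ℕ ℚ)⟦X⟧))
      = 1 - (complSeries k b : (MvPolynomial ℕ ℚ)⟦X⟧) := by
  induction b with
  | zero => simp [complSeries, chain_zero]
  | succ b ih =>
    rw [Finset.sum_Icc_succ_top (by omega), ih]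
    simp

/-- The equations `P h = a h + (∑_{j ≤ k + 1 - h} P j) * P h` of the generating functions of
`k`-plane trees have at most one solution without constant terms. -/
theorem eq_of_treeSeries_equations {R : Type*} [CommRing R] (k : ℕ) (a P Q : ℕ → R⟦X⟧)
    (hP0 : ∀ h ∈ Finset.Icc 1 k, constantCoeff (P h) = 0)
    (hQ0 : ∀ h ∈ Finset.Icc 1 k, constantCoeff (Q h) = 0)
    (hP : ∀ h ∈ Finset.Icc 1 k, P h = a h + (∑ j ∈ Finset.Icc 1 (k + 1 - h), P j) * P h)
    (hQ : ∀ h ∈ Finset.Icc 1 k, Q h = a h + (∑ j ∈ Finset.Icc 1 (k + 1 - h), Q j) * Q h) :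
    ∀ h ∈ Finset.Icc 1 k, P h = Q h := by
  have hdvd : ∀ n : ℕ, ∀ h ∈ Finset.Icc 1 k, X ^ n ∣ P h - Q h := by
    intro n
    induction n with
    | zero => simp
    | succ n ih =>
      intro h hh
      have hsub : Finset.Icc 1 (k + 1 - h) ⊆ Finset.Icc 1 k :=
        Finset.Icc_subset_Icc_right (by have := Finset.mem_Icc.mp hh; omega)
      have heq : P h - Q h = (∑ j ∈ Finset.Icc 1 (k + 1 - h), P j) * (P h - Q h)
          + Q h * ∑ j ∈ Finset.Icc 1 (k + 1 - h), (P j - Q j) := by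
        rw [Finset.sum_sub_distrib]
        linear_combination hP h hh - hQ h hh
      rw [heq, pow_succ']
      refine dvd_add (mul_dvd_mul ?_ (ih h hh)) (mul_dvd_mul (X_dvd_iff.mpr (hQ0 h hh)) ?_)
      · exact Finset.dvd_sum fun j hj => X_dvd_iff.mpr (hP0 j (hsub hj))
      · exact Finset.dvd_sum fun j hj => ih j (hsub hj)
  intro h hh
  rw [← sub_eq_zero]
  ext n : 1
  exact X_pow_dvd_iff.mp (hdvd (n + 1) h hh) n (Nat.lt_succ_self n)

/-- After the substitution of `X / φ`, the generating functions of `k`-plane trees are differences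
of members of the chain. -/
theorem substDivUnit_treeSeries (k : ℕ) : ∀ h ∈ Finset.Icc 1 k,
    substDivUnit (altProd k k ^ 2)
      (PlaneTree.treeSeries k (fun a => (MvPolynomial.X (labelPos k a) : MvPolynomial ℕ ℚ)) h)
      = (complSeries k (h - 1) : (MvPolynomial ℕ ℚ)⟦X⟧)
        - (complSeries k h : (MvPolynomial ℕ ℚ)⟦X⟧) := by
  refine eq_of_treeSeries_equations k
    (fun h => C (MvPolynomial.X (labelPos k h)) * divUnit (altProd k k ^ 2)) _
    (fun h => (complSeries k (h - 1) : (MvPolynomial ℕ ℚ)⟦X⟧)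
      - (complSeries k h : (MvPolynomial ℕ ℚ)⟦X⟧)) ?_ ?_ ?_ ?_
  · exact fun h _ => constantCoeff_substDivUnit _ _ (PlaneTree.constantCoeff_treeSeries k _ h)
  · intro h hh
    have h1 := congrArg constantCoeff (complSeries_sub_mul hh)
    have h2 : IsUnit (constantCoeff (complSeries k (k + 1 - h) : (MvPolynomial ℕ ℚ)⟦X⟧)) :=
      (Units.isUnit _).map _
    rw [map_mul, map_mul, divUnit, map_mul, constantCoeff_X, zero_mul, mul_zero] at h1
    exact (h2.mul_left_eq_zero).mp h1
  · intro h hh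
    conv_lhs => rw [PlaneTree.treeSeries_eq k _ hh]
    simp only [map_add, map_mul, map_sum, substDivUnit_X, substDivUnit_C]
    ring
  · intro h hh
    rw [sum_complSeries_sub, ← complSeries_sub_mul hh]
    ring

theorem substDivUnit_one_sub_sum_treeSeries {k b : ℕ} (hb : b ≤ k) :
    substDivUnit (altProd k k ^ 2) (1 - ∑ h ∈ Finset.Icc 1 b, PlaneTree.treeSeries k
      (fun a => (MvPolynomial.X (labelPos k a) : MvPolynomial ℕ ℚ)) h) = complSeries k b := by
  rw [map_sub, map_one, map_sum, Finset.sum_congr rfl fun h hh => substDivUnit_treeSeries k h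
    (Finset.Icc_subset_Icc_right hb hh), sum_complSeries_sub]
  ring

/-- Lagrange inversion for the generating function of all `k`-plane trees. -/
theorem succ_mul_coeff_sum_treeSeries {k : ℕ} (hk : 0 < k) (N : ℕ) :
    (N + 1 : MvPolynomial ℕ ℚ) * coeff (N + 2) (∑ h ∈ Finset.Icc 1 k, PlaneTree.treeSeries k
      (fun a => (MvPolynomial.X (labelPos k a) : MvPolynomial ℕ ℚ)) h)
      = coeff (N + 2) (↑((altProd k k ^ 2) ^ (N + 1)) : (MvPolynomial ℕ ℚ)⟦X⟧) := by
  set φ := altProd k k ^ 2 with hφ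
  set F := ∑ h ∈ Finset.Icc 1 k, PlaneTree.treeSeries k
      (fun a => (MvPolynomial.X (labelPos k a) : MvPolynomial ℕ ℚ)) h with hF
  have hU : complSeries k k = linFactor k 0 * φ⁻¹ := by
    have := chain_mul_chain_succ k 0
    rw [chain_zero, one_mul] at this
    rw [← this, complSeries, if_neg (by omega), Nat.sub_self]
  have hσ : substDivUnit φ F = 1 - (linFactor k 0 : (MvPolynomial ℕ ℚ)⟦X⟧) * ↑φ⁻¹ := by
    rw [← Units.val_mul, ← hU, ← substDivUnit_one_sub_sum_treeSeries le_rfl, ← hF, map_sub, map_one]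
    ring
  have hL := succ_mul_coeff_eq_coeff_derivative_substDivUnit φ F (N + 1)
  rw [hσ] at hL
  set Ψ := (φ : (MvPolynomial ℕ ℚ)⟦X⟧) ^ (N + 1) with hΨ
  have hinv : (↑φ⁻¹ : (MvPolynomial ℕ ℚ)⟦X⟧) * φ = 1 := by simp
  have hd : d⁄dX (MvPolynomial ℕ ℚ) Ψ
      = ((N + 1 : ℕ) : (MvPolynomial ℕ ℚ)⟦X⟧)
        * (φ ^ N * d⁄dX (MvPolynomial ℕ ℚ) (φ : (MvPolynomial ℕ ℚ)⟦X⟧)) := by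
    rw [hΨ, Derivation.leibniz_pow]
    simp
  have hdL : d⁄dX (MvPolynomial ℕ ℚ) (linFactor k 0 : (MvPolynomial ℕ ℚ)⟦X⟧) = C (altTail k 0) := by
    rw [val_linFactor, map_add, Derivation.map_one_eq_zero, Derivation.leibniz, derivative_C,
      derivative_X]
    simp
  have hexp : ((N + 1 : ℕ) : (MvPolynomial ℕ ℚ)⟦X⟧)
        * (d⁄dX (MvPolynomial ℕ ℚ) (1 - (linFactor k 0 : (MvPolynomial ℕ ℚ)⟦X⟧) * ↑φ⁻¹)
          * (φ : (MvPolynomial ℕ ℚ)⟦X⟧) ^ (N + 1 + 1))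
      = d⁄dX (MvPolynomial ℕ ℚ) Ψ + X * (C (altTail k 0) * d⁄dX (MvPolynomial ℕ ℚ) Ψ)
        - ((N + 1 : ℕ) : (MvPolynomial ℕ ℚ)⟦X⟧) * (C (altTail k 0) * Ψ) := by
    rw [map_sub, Derivation.map_one_eq_zero, Derivation.leibniz, Derivation.leibniz_units_inv, hdL,
      hd, hΨ, val_linFactor]
    simp only [smul_eq_mul]
    linear_combination ((N + 1 : ℕ) : (MvPolynomial ℕ ℚ)⟦X⟧)
      * ((1 + X * C (altTail k 0)) * φ ^ N * d⁄dX (MvPolynomial ℕ ℚ) (φ : (MvPolynomial ℕ ℚ)⟦X⟧)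
          * (1 + ↑φ⁻¹ * φ) - φ ^ (N + 1) * C (altTail k 0)) * hinv
  have hc := congrArg (coeff (N + 1)) hexp
  rw [← nsmul_eq_mul, map_nsmul, ← hL, map_sub, map_add, coeff_derivative, coeff_succ_X_mul,
    coeff_C_mul, coeff_derivative, ← nsmul_eq_mul, map_nsmul, coeff_C_mul] at hc
  simp only [nsmul_eq_mul] at hc
  push_cast at hc
  have hne : ((N : MvPolynomial ℕ ℚ) + 2) ≠ 0 := by
    exact_mod_cast (by omega : N + 2 ≠ 0)
  apply mul_left_cancel₀ hne
  rw [Units.val_pow_eq_pow_val, ← hΨ]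
  linear_combination hc

/-- Lagrange inversion for the generating function of the branches at a root labelled `h`. The
derivative with respect to `X` is traded for the one with respect to the variable of `h`. -/
theorem mul_coeff_inv_one_sub_sum_treeSeries {k h : ℕ} (hh : h ∈ Finset.Icc 1 k) (N : ℕ)
    (W : (MvPolynomial ℕ ℚ)⟦X⟧)
    (hW : (1 - ∑ j ∈ Finset.Icc 1 (k + 1 - h), PlaneTree.treeSeries k
      (fun a => (MvPolynomial.X (labelPos k a) : MvPolynomial ℕ ℚ)) j) * W = 1) :
    (Even (labelPos k h) → ((N : MvPolynomial ℕ ℚ) + 2) * (2 * N + 3) * coeff (N + 1) W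
      = coeff (N + 2) (coeffPderiv (labelPos k h)
        ↑(altProd k (labelPos k h + 1) ^ (-1 : ℤ) * altProd k k ^ (2 * (N + 2) : ℤ)))) ∧
    (Odd (labelPos k h) → ((N : MvPolynomial ℕ ℚ) + 1) * (2 * N + 3) * coeff (N + 1) W
      = coeff (N + 2) (coeffPderiv (labelPos k h)
        ↑(altProd k (labelPos k h + 1) ^ (1 : ℤ) * altProd k k ^ (2 * (N + 1) : ℤ)))) := by
  have hh' := Finset.mem_Icc.mp hh
  set j := labelPos k h with hj
  have hjk : j < k := labelPos_lt hh
  set φ := altProd k k ^ 2 with hφ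
  set B := altProd k (j + 1) with hB
  have hσ : substDivUnit φ W = ↑(chain k (j + 1))⁻¹ := by
    have := congrArg (substDivUnit φ) hW
    rw [map_mul, map_one, substDivUnit_one_sub_sum_treeSeries (by omega), complSeries_sub_eq hh,
      ← hj] at this
    exact Units.eq_inv_of_mul_eq_one_right (by rw [mul_comm]; exact this)
  have hzpow : ∀ M : ℕ, altProd k k ^ (2 * M : ℤ) = φ ^ M := by
    intro M
    rw [hφ, ← pow_mul, ← zpow_natCast]
    push_cast
    rfl
  have hinv : (↑B⁻¹ : (MvPolynomial ℕ ℚ)⟦X⟧) * B = 1 := by simp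
  have hE := eulerPderiv_altProd (k := k) (i := j + 1) (j := j) le_rfl hjk
  rw [eulerPderiv_apply, ← hB] at hE
  constructor
  · intro he
    have h1 : (j + 1) % 2 = 1 := by have := Nat.even_iff.mp he; omega
    rw [chain_of_odd k he.add_one, mul_inv, inv_inv, ← hφ, ← hB] at hσ
    -- the image of `W` is `φ / B`; inverting `X * W` instead removes the factor `φ`
    have hL := succ_mul_coeff_eq_coeff_derivative_substDivUnit φ (X * W) (N + 1)
    have hXW : substDivUnit φ (X * W) = X * (↑B⁻¹ : (MvPolynomial ℕ ℚ)⟦X⟧) := by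
      have : (↑φ⁻¹ : (MvPolynomial ℕ ℚ)⟦X⟧) * φ = 1 := by simp
      rw [map_mul, substDivUnit_X, hσ, divUnit, Units.val_mul]
      linear_combination X * (↑B⁻¹ : (MvPolynomial ℕ ℚ)⟦X⟧) * this
    rw [hXW, coeff_succ_X_mul] at hL
    have hD := coeffPderiv_altProd_zpow_mul hjk (-1) (2 * ((N + 2 : ℕ) : ℤ))
    have hcast : (2 * (N + 2) : ℤ) = 2 * ((N + 2 : ℕ) : ℤ) := by push_cast; rfl
    rw [hcast, hD, hzpow, ← hB]
    have hB2 : (↑(B ^ (-1 - 1 : ℤ) * φ ^ (N + 2)) : (MvPolynomial ℕ ℚ)⟦X⟧)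
        = (↑B⁻¹ : (MvPolynomial ℕ ℚ)⟦X⟧) ^ 2 * φ ^ (N + 2) := by
      rw [Units.val_mul, Units.val_pow_eq_pow_val, ← Units.val_pow_eq_pow_val]
      congr 2
    rw [h1, he.neg_one_pow] at hE
    have hkey : ((-1 + 2 * ((N + 2 : ℕ) : ℤ) : ℤ) : (MvPolynomial ℕ ℚ)⟦X⟧)
          * (↑(B ^ (-1 - 1 : ℤ) * φ ^ (N + 2)) : (MvPolynomial ℕ ℚ)⟦X⟧)
          * coeffPderiv j (B : (MvPolynomial ℕ ℚ)⟦X⟧)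
        = ((2 * N + 3 : ℕ) : (MvPolynomial ℕ ℚ)⟦X⟧) * (X * (d⁄dX (MvPolynomial ℕ ℚ)
          (X * (↑B⁻¹ : (MvPolynomial ℕ ℚ)⟦X⟧)) * (φ : (MvPolynomial ℕ ℚ)⟦X⟧) ^ (N + 1 + 1))) := by
      rw [hB2, Derivation.leibniz, derivative_X, Derivation.leibniz_units_inv]
      simp only [smul_eq_mul]
      push_cast at hE ⊢
      linear_combination (2 * (N : (MvPolynomial ℕ ℚ)⟦X⟧) + 3) * (↑B⁻¹ : (MvPolynomial ℕ ℚ)⟦X⟧) ^ 2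
        * φ ^ (N + 2) * hE + (2 * (N : (MvPolynomial ℕ ℚ)⟦X⟧) + 3) * (↑B⁻¹ : (MvPolynomial ℕ ℚ)⟦X⟧)
        * φ ^ (N + 2) * X * hinv
    rw [hkey, ← nsmul_eq_mul, map_nsmul, coeff_succ_X_mul, ← hL, nsmul_eq_mul]
    push_cast
    ring
  · intro ho
    have h1 : (j + 1) % 2 = 0 := by have := Nat.odd_iff.mp ho; omega
    rw [chain_of_even k ho.add_one, inv_inv, ← hB] at hσ
    have hL := succ_mul_coeff_eq_coeff_derivative_substDivUnit φ W N
    rw [hσ] at hL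
    have hD := coeffPderiv_altProd_zpow_mul hjk 1 (2 * ((N + 1 : ℕ) : ℤ))
    have hcast : (2 * (N + 1) : ℤ) = 2 * ((N + 1 : ℕ) : ℤ) := by push_cast; rfl
    rw [hcast, hD, hzpow, ← hB, sub_self, zpow_zero, one_mul, Units.val_pow_eq_pow_val]
    rw [h1, ho.neg_one_pow] at hE
    have hkey : ((1 + 2 * ((N + 1 : ℕ) : ℤ) : ℤ) : (MvPolynomial ℕ ℚ)⟦X⟧)
          * (φ : (MvPolynomial ℕ ℚ)⟦X⟧) ^ (N + 1) * coeffPderiv j (B : (MvPolynomial ℕ ℚ)⟦X⟧)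
        = ((2 * N + 3 : ℕ) : (MvPolynomial ℕ ℚ)⟦X⟧) * (X * (X * (d⁄dX (MvPolynomial ℕ ℚ)
          (B : (MvPolynomial ℕ ℚ)⟦X⟧) * (φ : (MvPolynomial ℕ ℚ)⟦X⟧) ^ (N + 1)))) := by
      push_cast at hE ⊢
      linear_combination (-(2 * (N : (MvPolynomial ℕ ℚ)⟦X⟧) + 3)) * φ ^ (N + 1) * hE
    rw [hkey, ← nsmul_eq_mul, map_nsmul, coeff_succ_X_mul, coeff_succ_X_mul, ← hL, nsmul_eq_mul]
    push_cast
    ring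

end Parametrisation

/-! ### Reading off the coefficients in the original order of the labels -/

section LabelOrder

theorem Nat.ceilDiv_two (k : ℕ) : k ⌈/⌉ 2 = (k + 1) / 2 := by
  rw [Nat.ceilDiv_eq_add_pred_div]
  rfl

theorem prod_range_eq_prod_even_mul_prod_odd {M : Type*} [CommMonoid M] (k : ℕ) (f : ℕ → M) :
    ∏ j ∈ Finset.range k, f j = (∏ r ∈ Finset.Icc 1 (k ⌈/⌉ 2), f (2 * r - 2))
      * ∏ r ∈ Finset.Icc 1 (k / 2), f (2 * r - 1) := by
  rw [Nat.ceilDiv_two]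
  induction k with
  | zero => simp
  | succ k ih =>
    rw [Finset.prod_range_succ, ih]
    obtain ⟨d, rfl | rfl⟩ := Nat.even_or_odd' k
    · have h1 : (2 * d + 1) / 2 = d := by omega
      have h2 : (2 * d + 1 + 1) / 2 = d + 1 := by omega
      have h3 : 2 * d / 2 = d := by omega
      rw [h1, h2, h3, Finset.prod_Icc_succ_top (by omega : 1 ≤ d + 1) (fun r => f (2 * r - 2)),
        show 2 * (d + 1) - 2 = 2 * d by omega]
      exact mul_right_comm _ _ _
    · have h1 : (2 * d + 1) / 2 = d := by omega
      have h2 : (2 * d + 1 + 1) / 2 = d + 1 := by omega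
      have h3 : (2 * d + 1 + 1 + 1) / 2 = d + 1 := by omega
      rw [h1, h2, h3, Finset.prod_Icc_succ_top (by omega : 1 ≤ d + 1) (fun r => f (2 * r - 1)),
        show 2 * (d + 1) - 1 = 2 * d + 1 by omega]
      exact mul_assoc _ _ _

theorem prod_Icc_one_eq_mul {M : Type*} [CommMonoid M] (f : ℕ → M) {a b : ℕ} (h : a ≤ b) :
    ∏ r ∈ Finset.Icc 1 b, f r = (∏ r ∈ Finset.Icc 1 a, f r) * ∏ r ∈ Finset.Icc (a + 1) b, f r := by
  induction b, h using Nat.le_induction with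
  | base => simp
  | succ b hb ih =>
    rw [Finset.prod_Icc_succ_top (by omega), ih, Finset.prod_Icc_succ_top (by omega), mul_assoc]

theorem sum_range_labelAt {M : Type*} [AddCommMonoid M] (k : ℕ) (f : ℕ → M) {r : ℕ}
    (hr : 2 * r ≤ k) :
    ∑ j ∈ Finset.range (2 * r), f (labelAt k j)
      = ∑ i ∈ Finset.Icc 1 r, f i + ∑ i ∈ Finset.Icc (k + 1 - r) k, f i := by
  induction r with
  | zero => simp
  | succ r ih =>
    have h1 : labelAt k (2 * r) = r + 1 := by rw [labelAt]; split_ifs <;> omega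
    have h2 : labelAt k (2 * r + 1) = k - r := by rw [labelAt]; split_ifs <;> omega
    rw [show 2 * (r + 1) = 2 * r + 1 + 1 by ring, Finset.sum_range_succ, Finset.sum_range_succ,
      ih (by omega), Finset.sum_Icc_succ_top (by omega), h1, h2,
      show k + 1 - (r + 1) = k - r by omega,
      ← Finset.add_sum_Ioc_eq_sum_Icc (show k - r ≤ k by omega),
      show Finset.Ioc (k - r) k = Finset.Icc (k + 1 - r) k by
        ext; simp only [Finset.mem_Ioc, Finset.mem_Icc]; omega]
    abel

/-- The exponents of the variables at the positions `0, …, k - 1` when the label `a` is used `ℓ a`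
times. -/
noncomputable def labelExponent (k : ℕ) (ℓ : ℕ → ℕ) : ℕ →₀ ℕ :=
  Finsupp.onFinset (Finset.range k) (fun j => if j < k then ℓ (labelAt k j) else 0) (by
    intro j hj
    by_contra h
    simp only [Finset.mem_range] at h
    simp [h] at hj)

theorem labelExponent_of_lt {k j : ℕ} (ℓ : ℕ → ℕ) (hj : j < k) :
    labelExponent k ℓ j = ℓ (labelAt k j) := by
  simp [labelExponent, hj]

theorem labelExponent_of_le {k j : ℕ} (ℓ : ℕ → ℕ) (hj : k ≤ j) : labelExponent k ℓ j = 0 := by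
  simp [labelExponent, hj.not_gt]

theorem degree_labelExponent (k : ℕ) (ℓ : ℕ → ℕ) :
    (labelExponent k ℓ).degree = ∑ i ∈ Finset.Icc 1 k, ℓ i := by
  have hsupp : (labelExponent k ℓ).support ⊆ Finset.range k := Finsupp.support_onFinset_subset
  rw [Finsupp.degree_apply, Finset.sum_subset hsupp]
  · refine Finset.sum_nbij' (labelAt k) (labelPos k) ?_ ?_ ?_ ?_ ?_
    · exact fun j hj => labelAt_mem (Finset.mem_range.mp hj)
    · exact fun a ha => Finset.mem_range.mpr (labelPos_lt ha)
    · exact fun j hj => (labelPos_eq_iff (labelAt_mem (Finset.mem_range.mp hj))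
        (Finset.mem_range.mp hj)).mpr rfl
    · exact fun a ha => labelAt_labelPos ha
    · exact fun j hj => labelExponent_of_lt ℓ (Finset.mem_range.mp hj)
  · exact fun j _ hj => Finsupp.notMem_support_iff.mp hj

/-- `diagCoeff_prod_linFactor_zpow` for the exponents that occur in the enumeration of trees, in
terms of the original order of the labels. -/
theorem diagCoeff_altProd_zpow_mul (k : ℕ) (ℓ : ℕ → ℕ) {j : ℕ} (hj : j ≤ k) (p q : ℤ) :
    diagCoeff (labelExponent k ℓ) ↑(altProd k j ^ p * altProd k k ^ q)
      = (∏ r ∈ Finset.Icc 1 (k ⌈/⌉ 2),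
          ((Ring.choose (((min (2 * r - 1) j % 2 : ℕ) : ℤ) * p + q
            - ∑ j ∈ Finset.Icc 1 (r - 1), (ℓ j : ℤ)
            - ∑ j ∈ Finset.Icc (k + 2 - r) k, (ℓ j : ℤ)) (ℓ r) : ℤ) : ℚ)) *
        (∏ r ∈ Finset.Icc 1 (k / 2),
          ((Ring.choose (∑ j ∈ Finset.Icc 1 r, (ℓ j : ℤ)
            + ∑ j ∈ Finset.Icc (k + 1 - r) k, (ℓ j : ℤ) - 1
            - ((min (2 * r) j % 2 : ℕ) : ℤ) * p) (ℓ (k + 1 - r)) : ℤ) : ℚ)) := by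
  rw [altProd_zpow_mul_altProd_zpow k j hj, diagCoeff_prod_linFactor_zpow k _ _ (fun i hi => by
    by_contra h
    exact hi (labelExponent_of_le ℓ (by omega))), prod_range_eq_prod_even_mul_prod_odd]
  have hsum : ∀ t ≤ k, ∑ i ∈ Finset.range t, (labelExponent k ℓ i : ℤ)
      = ∑ i ∈ Finset.range t, (ℓ (labelAt k i) : ℤ) := by
    intro t ht
    refine Finset.sum_congr rfl fun i hi => ?_
    rw [labelExponent_of_lt ℓ (by have := Finset.mem_range.mp hi; omega)]
  congr 1
  · refine Finset.prod_congr rfl fun r hr => ?_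
    rw [Nat.ceilDiv_two, Finset.mem_Icc] at hr
    obtain ⟨s, rfl⟩ : ∃ s, r = s + 1 := ⟨r - 1, by omega⟩
    have h1 : 2 * (s + 1) - 2 = 2 * s := by omega
    have h2 : labelAt k (2 * s) = s + 1 := by rw [labelAt]; split_ifs <;> omega
    have h3 : (2 * s + 1) % 2 = 1 := by omega
    rw [h1, labelExponent_of_lt ℓ (by omega), h2, hsum _ (by omega),
      sum_range_labelAt k (fun i => (ℓ i : ℤ)) (by omega), sum_range_neg_one_pow_mul, h3,
      show 2 * (s + 1) - 1 = 2 * s + 1 by omega, Nat.add_sub_cancel,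
      show k + 2 - (s + 1) = k + 1 - s by omega, mul_assoc, pow_mul]
    simp only [neg_one_sq, one_pow, one_mul, Nat.cast_one]
    rw [sub_sub _ (∑ i ∈ Finset.Icc 1 s, (ℓ i : ℤ))]
  · refine Finset.prod_congr rfl fun r hr => ?_
    rw [Finset.mem_Icc] at hr
    obtain ⟨s, rfl⟩ : ∃ s, r = s + 1 := ⟨r - 1, by omega⟩
    have h1 : 2 * (s + 1) - 1 = 2 * s + 1 := by omega
    have h2 : labelAt k (2 * s + 1) = k - s := by rw [labelAt]; split_ifs <;> omega
    have h3 : (2 * s + 1 + 1) % 2 = 0 := by omega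
    have hM := sum_range_labelAt k (fun i => (ℓ i : ℤ)) (r := s + 1) (by omega)
    rw [show 2 * (s + 1) = 2 * s + 1 + 1 by ring, Finset.sum_range_succ, h2] at hM
    rw [h1, labelExponent_of_lt ℓ (by omega), h2, hsum _ (by omega), sum_range_neg_one_pow_mul, h3,
      show k + 1 - (s + 1) = k - s by omega]
    rw [show k + 1 - (s + 1) = k - s by omega] at hM
    rw [← hM, show 2 * (s + 1) = 2 * s + 1 + 1 by ring]
    set S := ∑ i ∈ Finset.range (2 * s + 1), (ℓ (labelAt k i) : ℤ)
    set c := ((min (2 * s + 1 + 1) j % 2 : ℕ) : ℤ)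
    -- the sign of `x_j` at an odd position is absorbed by the reflection of the upper entry
    have hneg := Ring.choose_neg (S - c * p) (ℓ (k - s))
    rw [show c * p + ((0 : ℕ) : ℤ) * q - S = -(S - c * p) by push_cast; ring, hneg,
      show S - c * p + (ℓ (k - s) : ℤ) - 1 = S + (ℓ (k - s) : ℤ) - 1 - c * p by ring,
      pow_mul, Odd.neg_one_pow (by simp), Units.smul_def, smul_eq_mul, Int.cast_mul, ← mul_assoc]
    have : ((-1 : ℚ) ^ ℓ (k - s)) * (((Int.negOnePow (ℓ (k - s) : ℤ) : ℤˣ) : ℤ) : ℚ) = 1 := by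
      rcases Nat.even_or_odd (ℓ (k - s)) with h | h
      · rw [h.neg_one_pow, Int.negOnePow_even _ (by exact_mod_cast h)]; simp
      · rw [h.neg_one_pow, Int.negOnePow_odd _ (by exact_mod_cast h)]; simp
    rw [this, one_mul]

end LabelOrder

/-! ### Numbers of trees as coefficients -/

namespace PlaneTree

theorem prod_map_X_eq_monomial (f : ℕ → ℕ) (l : List ℕ) :
    (l.map fun a => (MvPolynomial.X (f a) : MvPolynomial ℕ ℚ)).prod
      = MvPolynomial.monomial (Multiset.toFinsupp (l.map f : Multiset ℕ)) 1 := by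
  induction l with
  | nil => simp
  | cons a l ih =>
    rw [List.map_cons, List.prod_cons, ih, MvPolynomial.X, MvPolynomial.monomial_mul, List.map_cons,
      ← Multiset.cons_coe, ← Multiset.singleton_add, map_add, Multiset.toFinsupp_singleton, one_mul]

theorem count_map_labelPos {k j : ℕ} (hj : j < k) (l : List ℕ) (hl : ∀ a ∈ l, a ∈ Finset.Icc 1 k) :
    (l.map (labelPos k)).count j = l.count (labelAt k j) := by
  induction l with
  | nil => simp
  | cons a l ih =>
    have h := labelPos_eq_iff (hl a (by simp)) hj
    rw [List.map_cons, List.count_cons, List.count_cons, ih fun b hb => hl b (by simp [hb])]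
    simp [h]

theorem coeff_weight {k : ℕ} (ℓ : ℕ → ℕ) {T : PlaneTree ℕ} (hT : IsKPlane k T)
    [Decidable (∀ i ∈ Finset.Icc 1 k, T.labelCount i = ℓ i)] :
    MvPolynomial.coeff (labelExponent k ℓ)
      (weight (fun a => (MvPolynomial.X (labelPos k a) : MvPolynomial ℕ ℚ)) T)
      = if ∀ i ∈ Finset.Icc 1 k, T.labelCount i = ℓ i then 1 else 0 := by
  classical
  rw [weight, prod_map_X_eq_monomial, MvPolynomial.coeff_monomial]
  congr 1
  rw [eq_iff_iff]
  have hmem := hT.labels_mem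
  constructor
  · intro h i hi
    have h1 := DFunLike.congr_fun h (labelPos k i)
    rw [Multiset.toFinsupp_apply, Multiset.coe_count, count_map_labelPos (labelPos_lt hi) _ hmem,
      labelExponent_of_lt ℓ (labelPos_lt hi), labelAt_labelPos hi] at h1
    exact h1
  · intro h
    ext j
    rw [Multiset.toFinsupp_apply, Multiset.coe_count]
    by_cases hj : j < k
    · rw [count_map_labelPos hj _ hmem, labelExponent_of_lt ℓ hj]
      exact h _ (labelAt_mem hj)
    · rw [labelExponent_of_le ℓ (by omega), List.count_eq_zero]
      intro hmem'
      obtain ⟨a, ha, rfl⟩ := List.mem_map.mp hmem'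
      exact hj (labelPos_lt (hmem a ha))

theorem finite_kPlaneTreesWithRoot (k n : ℕ) (ℓ : ℕ → ℕ) (h : ℕ) :
    (kPlaneTreesWithRoot k n ℓ h).Finite :=
  (finite_treesOfSize k h n).subset fun _ hT => ⟨hT.1.1, hT.2, hT.1.2.1⟩

theorem ncard_kPlaneTreesWithRoot (k n : ℕ) (ℓ : ℕ → ℕ) (h : ℕ) :
    ((kPlaneTreesWithRoot k n ℓ h).ncard : ℚ)
      = MvPolynomial.coeff (labelExponent k ℓ) (PowerSeries.coeff n (treeSeries k
          (fun a => (MvPolynomial.X (labelPos k a) : MvPolynomial ℕ ℚ)) h)) := by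
  classical
  have hset : kPlaneTreesWithRoot k n ℓ h
      = ((treeFinset k h n).filter fun T => ∀ i ∈ Finset.Icc 1 k, T.labelCount i = ℓ i) := by
    ext T
    simp only [kPlaneTreesWithRoot, kPlaneTrees, Set.mem_ofPred_eq, Finset.coe_filter,
      mem_treeFinset]
    tauto
  rw [hset, Set.ncard_coe_finset, coeff_treeSeries, MvPolynomial.coeff_sum, Finset.card_filter]
  push_cast
  refine Finset.sum_congr rfl fun T hT => ?_
  rw [coeff_weight ℓ (mem_treeFinset.mp hT).1]

theorem kPlaneTrees_eq_biUnion (k n : ℕ) (ℓ : ℕ → ℕ) :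
    kPlaneTrees k n ℓ = ⋃ h ∈ Finset.Icc 1 k, kPlaneTreesWithRoot k n ℓ h := by
  ext T
  simp only [kPlaneTreesWithRoot, Set.mem_iUnion, Set.mem_ofPred_eq, exists_prop]
  exact ⟨fun hT => ⟨_, hT.1.rootLabel_mem, hT, rfl⟩, fun ⟨_, _, hT, _⟩ => hT⟩

theorem finite_kPlaneTrees (k n : ℕ) (ℓ : ℕ → ℕ) : (kPlaneTrees k n ℓ).Finite := by
  rw [kPlaneTrees_eq_biUnion]
  exact Set.Finite.biUnion (Finset.finite_toSet _) fun h _ => finite_kPlaneTreesWithRoot k n ℓ h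

theorem ncard_kPlaneTrees (k n : ℕ) (ℓ : ℕ → ℕ) :
    (kPlaneTrees k n ℓ).ncard = ∑ h ∈ Finset.Icc 1 k, (kPlaneTreesWithRoot k n ℓ h).ncard := by
  rw [kPlaneTrees_eq_biUnion, ← finsum_mem_coe_finset]
  refine Set.Finite.ncard_biUnion (Finset.finite_toSet _)
    (fun h _ => finite_kPlaneTreesWithRoot k n ℓ h) fun h _ h' _ hne => ?_
  rw [Function.onFun, Set.disjoint_left]
  exact fun T hT hT' => hne (hT.2.symm.trans hT'.2)

open PowerSeries in
/-- The number of trees with a given root label, as a coefficient of a product of powers of the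
linear factors. -/
theorem mul_ncard_kPlaneTreesWithRoot {k N h : ℕ} (ℓ : ℕ → ℕ)
    (hℓ : N + 2 = ∑ i ∈ Finset.Icc 1 k, ℓ i) (hh : h ∈ Finset.Icc 1 k) :
    (Even (labelPos k h) →
      ((N : ℚ) + 2) * (2 * N + 3) * ((kPlaneTreesWithRoot k (N + 2) ℓ h).ncard : ℚ)
        = ℓ h * diagCoeff (labelExponent k ℓ)
          ↑(altProd k (labelPos k h + 1) ^ (-1 : ℤ) * altProd k k ^ (2 * (N + 2) : ℤ))) ∧
    (Odd (labelPos k h) →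
      ((N : ℚ) + 1) * (2 * N + 3) * ((kPlaneTreesWithRoot k (N + 2) ℓ h).ncard : ℚ)
        = ℓ h * diagCoeff (labelExponent k ℓ)
          ↑(altProd k (labelPos k h + 1) ^ (1 : ℤ) * altProd k k ^ (2 * (N + 1) : ℤ))) := by
  set x : ℕ → MvPolynomial ℕ ℚ := fun a => MvPolynomial.X (labelPos k a) with hx
  have hunit : IsUnit (1 - ∑ j ∈ Finset.Icc 1 (k + 1 - h), treeSeries k x j) := by
    rw [PowerSeries.isUnit_iff_constantCoeff, map_sub, map_sum]
    simp [constantCoeff_treeSeries]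
  obtain ⟨W, hW⟩ := hunit.exists_right_inv
  have hT : treeSeries k x h = X * (C (x h) * W) := by
    linear_combination (-treeSeries k x h) * hW + W * treeSeries_eq k x hh
  have hdeg := degree_labelExponent k ℓ
  rw [← hℓ] at hdeg
  have hlab : labelExponent k ℓ (labelPos k h) = ℓ h := by
    rw [labelExponent_of_lt ℓ (labelPos_lt hh), labelAt_labelPos hh]
  -- comparing coefficients of `x ^ ℓ` turns the derivative into multiplication by `ℓ h`
  have key : ∀ (c : ℕ) (Z : (MvPolynomial ℕ ℚ)⟦X⟧),
      (c : MvPolynomial ℕ ℚ) * coeff (N + 1) W = coeff (N + 2) (coeffPderiv (labelPos k h) Z) →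
      (c : ℚ) * ((kPlaneTreesWithRoot k (N + 2) ℓ h).ncard : ℚ)
        = ℓ h * diagCoeff (labelExponent k ℓ) Z := by
    intro c Z hc
    rw [ncard_kPlaneTreesWithRoot, ← hx, hT, coeff_succ_X_mul, coeff_C_mul, hx,
      MvPolynomial.coeff_X_mul', ← hlab]
    by_cases h0 : labelExponent k ℓ (labelPos k h) = 0
    · rw [if_neg (by simpa using h0), h0]
      simp
    · rw [if_pos (by simpa using h0)]
      have hm : labelExponent k ℓ - Finsupp.single (labelPos k h) 1
            + Finsupp.single (labelPos k h) 1
          = labelExponent k ℓ := by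
        refine tsub_add_cancel_of_le ?_
        rw [Finsupp.single_le_iff]
        omega
      have h1 := congrArg
        (MvPolynomial.coeff (labelExponent k ℓ - Finsupp.single (labelPos k h) 1)) hc
      rw [coeff_coeffPderiv, MvPolynomial.coeff_pderiv, hm, ← nsmul_eq_mul, MvPolynomial.coeff_smul,
        nsmul_eq_mul] at h1
      rw [h1, diagCoeff_apply, hdeg, mul_comm]
      congr 1
      rw [Finsupp.tsub_apply, Finsupp.single_eq_same]
      have : 1 ≤ labelExponent k ℓ (labelPos k h) := by omega
      push_cast [Nat.cast_sub this]
      ring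
  obtain ⟨heven, hodd⟩ := mul_coeff_inv_one_sub_sum_treeSeries hh N W hW
  constructor
  · intro he
    have := key ((N + 2) * (2 * N + 3)) _ (by rw [← heven he]; push_cast; ring)
    rw [← this]
    push_cast
    ring
  · intro ho
    have := key ((N + 1) * (2 * N + 3)) _ (by rw [← hodd ho]; push_cast; ring)
    rw [← this]
    push_cast
    ring

theorem mul_ncard_kPlaneTrees {k N : ℕ} (ℓ : ℕ → ℕ) (hk : 0 < k)
    (hℓ : N + 2 = ∑ i ∈ Finset.Icc 1 k, ℓ i) :
    ((N : ℚ) + 1) * ((kPlaneTrees k (N + 2) ℓ).ncard : ℚ)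
      = diagCoeff (labelExponent k ℓ)
          ↑(altProd k 0 ^ (0 : ℤ) * altProd k k ^ (2 * (N + 1) : ℤ)) := by
  have h1 := congrArg (MvPolynomial.coeff (labelExponent k ℓ)) (succ_mul_coeff_sum_treeSeries hk N)
  have hz : altProd k 0 ^ (0 : ℤ) * altProd k k ^ (2 * (N + 1) : ℤ)
      = (altProd k k ^ 2) ^ (N + 1) := by
    rw [zpow_zero, one_mul, ← pow_mul, ← zpow_natCast]
    push_cast
    rfl
  rw [hz, diagCoeff_apply, degree_labelExponent, ← hℓ, ← h1, ncard_kPlaneTrees, map_sum]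
  push_cast
  simp_rw [ncard_kPlaneTreesWithRoot]
  rw [← MvPolynomial.coeff_sum]
  have : ((N : MvPolynomial ℕ ℚ) + 1) = MvPolynomial.C ((N : ℚ) + 1) := by simp
  rw [this, MvPolynomial.coeff_C_mul]

end PlaneTree

theorem mainTheorem1 (k n : ℕ) (hn : 1 < n) (ℓ : ℕ → ℕ)
    (hℓ : n = ∑ i ∈ Finset.Icc 1 k, ℓ i) :
    (∀ h ∈ Finset.Icc 1 k,
      (PlaneTree.kPlaneTreesWithRoot k n ℓ h).Finite ∧
      (h ≤ k ⌈/⌉ 2 →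
        ((PlaneTree.kPlaneTreesWithRoot k n ℓ h).ncard : ℚ) =
          (ℓ h : ℚ) / ((n : ℚ) * (2 * (n : ℚ) - 1)) *
          (∏ r ∈ Finset.Icc 1 (k ⌈/⌉ 2),
            ((Ring.choose (2 * (n : ℤ) - 1 - ∑ j ∈ Finset.Icc 1 (r - 1), (ℓ j : ℤ)
              - ∑ j ∈ Finset.Icc (k + 2 - r) k, (ℓ j : ℤ)) (ℓ r) : ℤ) : ℚ)) *
          (∏ r ∈ Finset.Icc 1 (h - 1),
            ((Ring.choose (∑ j ∈ Finset.Icc 1 r, (ℓ j : ℤ)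
              + ∑ j ∈ Finset.Icc (k + 1 - r) k, (ℓ j : ℤ) - 1) (ℓ (k + 1 - r)) : ℤ) : ℚ)) *
          (∏ r ∈ Finset.Icc h (k / 2),
            ((Ring.choose (∑ j ∈ Finset.Icc 1 r, (ℓ j : ℤ)
              + ∑ j ∈ Finset.Icc (k + 1 - r) k, (ℓ j : ℤ)) (ℓ (k + 1 - r)) : ℤ) : ℚ))) ∧
      (k ⌈/⌉ 2 < h →
        ((PlaneTree.kPlaneTreesWithRoot k n ℓ h).ncard : ℚ) =
          (ℓ h : ℚ) / (((n : ℚ) - 1) * (2 * (n : ℚ) - 1)) *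
          (∏ r ∈ Finset.Icc 1 (k + 1 - h),
            ((Ring.choose (2 * (n : ℤ) - 1 - ∑ j ∈ Finset.Icc 1 (r - 1), (ℓ j : ℤ)
              - ∑ j ∈ Finset.Icc (k + 2 - r) k, (ℓ j : ℤ)) (ℓ r) : ℤ) : ℚ)) *
          (∏ r ∈ Finset.Icc (k + 2 - h) (k ⌈/⌉ 2),
            ((Ring.choose (2 * (n : ℤ) - 2 - ∑ j ∈ Finset.Icc 1 (r - 1), (ℓ j : ℤ)
              - ∑ j ∈ Finset.Icc (k + 2 - r) k, (ℓ j : ℤ)) (ℓ r) : ℤ) : ℚ)) *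
          (∏ r ∈ Finset.Icc 1 (k / 2),
            ((Ring.choose (∑ j ∈ Finset.Icc 1 r, (ℓ j : ℤ)
              + ∑ j ∈ Finset.Icc (k + 1 - r) k, (ℓ j : ℤ) - 1) (ℓ (k + 1 - r)) : ℤ) : ℚ)))) ∧
    (PlaneTree.kPlaneTrees k n ℓ).Finite ∧
    ((PlaneTree.kPlaneTrees k n ℓ).ncard : ℚ) =
      1 / ((n : ℚ) - 1) *
      (∏ r ∈ Finset.Icc 1 (k ⌈/⌉ 2),
        ((Ring.choose (2 * (n : ℤ) - 2 - ∑ j ∈ Finset.Icc 1 (r - 1), (ℓ j : ℤ)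
          - ∑ j ∈ Finset.Icc (k + 2 - r) k, (ℓ j : ℤ)) (ℓ r) : ℤ) : ℚ)) *
      (∏ r ∈ Finset.Icc 1 (k / 2),
        ((Ring.choose (∑ j ∈ Finset.Icc 1 r, (ℓ j : ℤ)
          + ∑ j ∈ Finset.Icc (k + 1 - r) k, (ℓ j : ℤ) - 1) (ℓ (k + 1 - r)) : ℤ) : ℚ)) := by
  obtain ⟨N, rfl⟩ : ∃ N, n = N + 2 := ⟨n - 2, by omega⟩
  have hk : 0 < k := by
    by_contra h
    obtain rfl : k = 0 := by omega
    simp at hℓ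
  refine ⟨fun h hh => ⟨PlaneTree.finite_kPlaneTreesWithRoot k _ ℓ h, fun hle => ?_, fun hlt => ?_⟩,
    PlaneTree.finite_kPlaneTrees k _ ℓ, ?_⟩
  · obtain ⟨h1, h2⟩ := Finset.mem_Icc.mp hh
    have hceil : k ⌈/⌉ 2 = (k + 1) / 2 := Nat.ceilDiv_two k
    have hpos : labelPos k h = 2 * h - 2 := by rw [labelPos, if_pos (by omega)]
    have hc := (PlaneTree.mul_ncard_kPlaneTreesWithRoot ℓ hℓ hh).1
      (by rw [hpos, Nat.even_iff]; omega)
    rw [hpos, show 2 * h - 2 + 1 = 2 * h - 1 by omega,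
      diagCoeff_altProd_zpow_mul k ℓ (by omega), prod_Icc_one_eq_mul _ (by omega : h - 1 ≤ k / 2),
      show h - 1 + 1 = h by omega] at hc
    -- only the first `2 * h - 1` factors enter the power `-1` of the shorter product
    have e1 : ∀ r ∈ Finset.Icc 1 (k ⌈/⌉ 2), min (2 * r - 1) (2 * h - 1) % 2 = 1 := by
      intro r hr
      have := Finset.mem_Icc.mp hr
      omega
    have e2 : ∀ r ∈ Finset.Icc 1 (h - 1), min (2 * r) (2 * h - 1) % 2 = 0 := by
      intro r hr
      have := Finset.mem_Icc.mp hr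
      omega
    have e3 : ∀ r ∈ Finset.Icc h (k / 2), min (2 * r) (2 * h - 1) % 2 = 1 := by
      intro r hr
      have := Finset.mem_Icc.mp hr
      omega
    rw [Finset.prod_congr rfl fun r hr => by rw [e1 r hr],
      Finset.prod_congr (s₁ := Finset.Icc 1 (h - 1)) rfl fun r hr => by rw [e2 r hr],
      Finset.prod_congr (s₁ := Finset.Icc h (k / 2)) rfl fun r hr => by rw [e3 r hr]] at hc
    simp only [Nat.cast_one, Nat.cast_zero, one_mul, zero_mul, sub_zero, sub_neg_eq_add,
      sub_add_cancel] at hc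
    rw [show (-1 + 2 * ((N : ℤ) + 2)) = 2 * ((N + 2 : ℕ) : ℤ) - 1 by push_cast; ring] at hc
    have hd : ((N + 2 : ℕ) : ℚ) * (2 * ((N + 2 : ℕ) : ℚ) - 1) = ((N : ℚ) + 2) * (2 * N + 3) := by
      push_cast; ring
    rw [hd, mul_assoc, mul_assoc, div_mul_eq_mul_div, eq_div_iff (by positivity), mul_comm, hc]
  · obtain ⟨h1, h2⟩ := Finset.mem_Icc.mp hh
    have hceil : k ⌈/⌉ 2 = (k + 1) / 2 := Nat.ceilDiv_two k
    have hpos : labelPos k h = 2 * (k - h) + 1 := by rw [labelPos, if_neg (by omega)]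
    have hc := (PlaneTree.mul_ncard_kPlaneTreesWithRoot ℓ hℓ hh).2
      (by rw [hpos, Nat.odd_iff]; omega)
    rw [hpos, show 2 * (k - h) + 1 + 1 = 2 * (k + 1 - h) by omega,
      diagCoeff_altProd_zpow_mul k ℓ (by omega),
      prod_Icc_one_eq_mul _ (by omega : k + 1 - h ≤ k ⌈/⌉ 2),
      show k + 1 - h + 1 = k + 2 - h by omega] at hc
    -- only the first `2 * (k + 1 - h)` factors enter the power `1` of the shorter product
    have e1 : ∀ r ∈ Finset.Icc 1 (k + 1 - h), min (2 * r - 1) (2 * (k + 1 - h)) % 2 = 1 := by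
      intro r hr
      have := Finset.mem_Icc.mp hr
      omega
    have e2 : ∀ r ∈ Finset.Icc (k + 2 - h) (k ⌈/⌉ 2),
        min (2 * r - 1) (2 * (k + 1 - h)) % 2 = 0 := by
      intro r hr
      have := Finset.mem_Icc.mp hr
      omega
    have e3 : ∀ r ∈ Finset.Icc 1 (k / 2), min (2 * r) (2 * (k + 1 - h)) % 2 = 0 := by
      intro r hr
      omega
    rw [Finset.prod_congr (s₁ := Finset.Icc 1 (k + 1 - h)) rfl fun r hr => by rw [e1 r hr],
      Finset.prod_congr (s₁ := Finset.Icc (k + 2 - h) (k ⌈/⌉ 2)) rfl fun r hr => by rw [e2 r hr],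
      Finset.prod_congr (s₁ := Finset.Icc 1 (k / 2)) rfl fun r hr => by rw [e3 r hr]] at hc
    simp only [Nat.cast_one, Nat.cast_zero, one_mul, zero_mul, sub_zero, zero_add] at hc
    rw [show (1 + 2 * ((N : ℤ) + 1)) = 2 * ((N + 2 : ℕ) : ℤ) - 1 by push_cast; ring,
      show (2 * ((N : ℤ) + 1)) = 2 * ((N + 2 : ℕ) : ℤ) - 2 by push_cast; ring] at hc
    have hd : (((N + 2 : ℕ) : ℚ) - 1) * (2 * ((N + 2 : ℕ) : ℚ) - 1)
        = ((N : ℚ) + 1) * (2 * N + 3) := by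
      push_cast; ring
    rw [hd, mul_assoc, mul_assoc, ← mul_assoc (∏ r ∈ Finset.Icc 1 (k + 1 - h), _),
      div_mul_eq_mul_div, eq_div_iff (by positivity), mul_comm, hc]
  · have hc := PlaneTree.mul_ncard_kPlaneTrees ℓ hk hℓ
    rw [diagCoeff_altProd_zpow_mul k ℓ (by omega)] at hc
    simp only [mul_zero, sub_zero, zero_add] at hc
    rw [show (2 * ((N : ℤ) + 1)) = 2 * ((N + 2 : ℕ) : ℤ) - 2 by push_cast; ring] at hc
    have hd : ((N + 2 : ℕ) : ℚ) - 1 = (N : ℚ) + 1 := by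
      push_cast; ring
    rw [hd, mul_assoc, div_mul_eq_mul_div, one_mul, eq_div_iff (by positivity), mul_comm, hc]
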